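/- **Model.** For each sample size $n$ let $m\ge 2$ (number of categories), $d$ (number of coefficients), a partition of $\{1,\dots,d\}$ into $p$ nonempty groups $G_1,\dots,G_p$, and design matrices $X_1,\dots,X_n\in\mathbb R^{(m-1)\times d}$, not all zero (for $n\ge1$), be given; all of these may depend on $n$. Write $g_j=|G_j|$, $\overline g=\max_j g_j$, $\beta_j$ for the subvector of $\beta\in\mathbb R^d$ indexed by $G_j$, and, for $S\subset\{1,\dots,p\}$, $\lVert\beta_S\rVert_{2,1}=\sum_{j\in S}\lVert\beta_j\rVert_2$, $\lVert\beta\rVert_{2,1}=\sum_{j=1}^p\lVert\beta_j\rVert_2$, $d_S=\sum_{j\in S}g_j$; $S_\beta=\{j:\beta_j\ne0\}$, $s_\beta=|S_\beta|$. For a matrix $A$ with $d$ columns, $\lVert A\rVert_\ast=\max_j\lVert A_{\cdot j}\rVert_{\rm sp}$, where $A_{\cdot j}$ consists of the columns in $G_j$ and $\lVert\cdot\rVert_{\rm sp}$ is the spectral norm. Let $X=(X_1^T,\dots,X_n^T)^T\in\mathbb R^{n(m-1)\times d}$. The responses $Z_1,\dots,Z_n\in\{0,\dots,m-1\}$ are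 independent with $\log\{\mathbb P(Z_i=\ell)/\mathbb P(Z_i=0)\}=(X_i\beta)_\ell$, $\ell=1,\dots,m-1$; put $Y_{i\ell}=\mathbb 1(Z_i=\ell)$, $Y=(Y_{i\ell})\in\mathbb R^{n(m-1)}$, and let $f_\beta^n$ be its probability mass function. For a true value $\beta_0$ write $S_0=S_{\beta_0}$, $s_0=s_{\beta_0}$, let $\mathbb E_0$ be the expectation under $\beta_0$, and let $W$ be the covariance matrix of $Y$ under $\beta_0$. The compatibility number is $$\phi(S)=\inf\Big\{\frac{\lVert W^{1/2}X\beta\rVert_2\sqrt{|S|}}{\lVert X\rVert_\ast\lVert\beta\rVert_{2,1}}:\ \lVert\beta_{S^c}\rVert_{2,1}\le7\lVert\beta_S\rVert_{2,1},\ \beta_S\neq0\Big\}.$$ **Prior.** Let $A_1,A_2,A_3,A_4>0$ be constants that do not depend on $n$, and let $\pi_p$ be a probability distribution on $\{0,\dots,p\}$ with $$\frac{A_1}{(p\vee n^{\overline g})^{A_3}}\le\frac{\pi_p(s)}{\pi_p(s-1)}\le\frac{A_2}{(p\vee n^{\overline g})^{A_4}},\qquad s=1,\dots,p.$$ The prior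 $\Pi$ of $\beta$ draws $s$ from $\pi_p$, then $S$ uniformly among the subsets of $\{1,\dots,p\}$ of size $s$, then $\beta_S\in\mathbb R^{d_S}$ from the density $$h_S(\beta_S)=\Big(\frac{\lambda}{\sqrt\pi}\Big)^{d_S}\frac{\prod_{j\in S}\Gamma(g_j/2)}{2^{s}\prod_{j\in S}\Gamma(g_j)}e^{-\lambda\lVert\beta_S\rVert_{2,1}},\qquad\lambda=8\lVert X\rVert_\ast\sqrt{\log p\vee\overline g\log n},$$ and sets $\beta_{S^c}=0$. The posterior $\Pi(\cdot\mid Y)$ is given by Bayes' rule, $\Pi(B\mid Y)=\int_B f_\beta^n(Y)\,d\Pi(\beta)\big/\int f_\beta^n(Y)\,d\Pi(\beta)$. **Theorem (Effective group size).** There is a constant $M_1>0$ (universal: independent of $A_1,\dots,A_4$, of $n$, and of all the data above) such that for all $A_1,\dots,A_4>0$, all sequences of models and priors as above, and every $M_2>3$, $$\sup_{\beta_0\in\mathcal B_1(M_1)}\mathbb E_0\,\Pi\Big\{\beta:\ s_\beta>s_0+\frac{M_2}{A_4}\Big(1+\frac{33}{\phi^2(S_0)}\Big)s_0\ \Big|\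 Y\Big\}\longrightarrow0\qquad(n\to\infty),$$ where $\mathcal B_1(M)=\{\beta_0\in\mathbb R^d:\ s_0\sqrt{\log p\vee\overline g\log n}\,\max_i\lVert X_i\rVert_\ast\le M\,\phi^2(S_0)\,\lVert X\rVert_\ast\}$. (The vector $\beta_0=0$ always belongs to $\mathcal B_1(M)$; for it the threshold $s_0+\cdots$ is $0$.) -/

import Mathlib

open scoped Matrix ENNReal MatrixOrder

noncomputable section

/-- Spectral norm of a real matrix: its operator norm between Euclidean spaces. -/
def specNorm {ι κ : Type*} [Fintype ι] [Fintype κ] [DecidableEq κ] (A : Matrix ι κ ℝ) : ℝ :=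
  ‖(Matrix.toEuclideanLin A).toContinuousLinearMap‖

/-- The Euclidean norm of a finite real vector. -/
def l2norm {ι : Type*} [Fintype ι] (v : ι → ℝ) : ℝ := ‖(WithLp.toLp 2 v : EuclideanSpace ℝ ι)‖

/-- A design for the multi-category logit model with `n` individuals, `m = r + 1 ≥ 2` categories
(category `0` is the reference), `d` coefficients and `p` nonempty groups that partition the
coefficients: coefficient `k` belongs to the group `grp k`, so `G_j = {k | grp k = j}`.
Row `ℓ` of `X i` is the covariate vector of individual `i` for the category `ℓ + 1`. -/
structure LogitDesign (n : ℕ) where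
  r : ℕ
  one_le_r : 1 ≤ r
  d : ℕ
  p : ℕ
  grp : Fin d → Fin p
  grp_surjective : Function.Surjective grp
  X : Fin n → Matrix (Fin r) (Fin d) ℝ

namespace LogitDesign

variable {n : ℕ} (D : LogitDesign n)

/-- The vectors `β`. -/
abbrev Coef : Type := Fin D.d → ℝ

/-- The possible responses `(Z_1, …, Z_n)`. -/
abbrev Response : Type := Fin n → Fin (D.r + 1)

/-! ### Groups and norms -/

/-- `g_j = |G_j|`. -/
def groupSize (j : Fin D.p) : ℕ := (Finset.univ.filter fun k => D.grp k = j).card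

/-- The maximal group size. -/
def maxGroupSize : ℕ := Finset.univ.sup D.groupSize

/-- `d_S`, the number of coefficients in the groups of `S`. -/
def dimOf (S : Finset (Fin D.p)) : ℕ := ∑ j ∈ S, D.groupSize j

/-- `‖β_j‖₂`, where `β_j` is the subvector of `β` for the group `j`. -/
def groupNorm (β : D.Coef) (j : Fin D.p) : ℝ :=
  l2norm fun k : {k : Fin D.d // D.grp k = j} => β k

/-- `‖β_S‖_{2,1}`. -/
def norm21On (S : Finset (Fin D.p)) (β : D.Coef) : ℝ := ∑ j ∈ S, D.groupNorm β j

/-- `‖β‖_{2,1}`. -/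
def norm21 (β : D.Coef) : ℝ := ∑ j, D.groupNorm β j

/-- `S_β`, the set of the groups on which `β` does not vanish. -/
def activeGroups (β : D.Coef) : Finset (Fin D.p) :=
  Finset.univ.filter fun j => ∃ k, D.grp k = j ∧ β k ≠ 0

/-- `s_β = |S_β|`. -/
def activeCount (β : D.Coef) : ℕ := (D.activeGroups β).card

/-- `‖A‖_* = max_j ‖A_{·j}‖_sp` for a matrix `A` with `d` columns. -/
def starNorm {ι : Type*} [Fintype ι] (A : Matrix ι (Fin D.d) ℝ) : ℝ :=
  ⨆ j : Fin D.p, specNorm (A.submatrix id fun k : {k : Fin D.d // D.grp k = j} => (k : Fin D.d))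

/-- The entire design matrix, obtained by stacking `X_1, …, X_n`. -/
def fullX : Matrix (Fin n × Fin D.r) (Fin D.d) ℝ := Matrix.of fun a k => D.X a.1 a.2 k

/-- `log p ∨ ḡ log n`. -/
def logFactor : ℝ := max (Real.log D.p) (D.maxGroupSize * Real.log n)

/-! ### The logit model -/

/-- `P(Z_i = c)` under `β`: with `θ = X_i β` it is `1 / (1 + ∑ exp θ_ℓ)` for the reference category
`c = 0` and `exp θ_ℓ / (1 + ∑ exp θ_ℓ)` for the category `c = ℓ + 1`. -/
def catProb (β : D.Coef) (i : Fin n) (c : Fin (D.r + 1)) : ℝ :=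
  (Fin.cases 1 (fun l => Real.exp ((D.X i *ᵥ β) l)) c : ℝ) /
    (1 + ∑ l, Real.exp ((D.X i *ᵥ β) l))

/-- The density of the independent responses with respect to the counting measure. -/
def lik (β : D.Coef) (z : D.Response) : ℝ := ∏ i, D.catProb β i (z i)

/-- The indicators `Y_{iℓ} = 1(Z_i = ℓ)`, `ℓ = 1, …, m - 1`. -/
def indic (z : D.Response) (a : Fin n × Fin D.r) : ℝ := if z a.1 = a.2.succ then 1 else 0

/-- `μ`, the mean of `Y` under the true parameter `β₀`. -/
def meanY (β₀ : D.Coef) (a : Fin n × Fin D.r) : ℝ := ∑ z, D.lik β₀ z * D.indic z a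

/-- `W`, the covariance matrix of `Y` under the true parameter `β₀`. -/
def covY (β₀ : D.Coef) : Matrix (Fin n × Fin D.r) (Fin n × Fin D.r) ℝ :=
  Matrix.of fun a b =>
    ∑ z, D.lik β₀ z * ((D.indic z a - D.meanY β₀ a) * (D.indic z b - D.meanY β₀ b))

/-- The compatibility number `φ(S)`, where `W` is taken under `β₀`. For `S = ∅` the infimum is over
the empty set and `sInf` returns `0`; this value is only ever used multiplied by `s = 0`. -/
def compat (β₀ : D.Coef) (S : Finset (Fin D.p)) : ℝ :=
  sInf {t : ℝ | ∃ β : D.Coef,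
    D.norm21On Sᶜ β ≤ 7 * D.norm21On S β ∧ (∃ k, D.grp k ∈ S ∧ β k ≠ 0) ∧
    t = l2norm (CFC.sqrt (D.covY β₀) *ᵥ (D.fullX *ᵥ β)) * Real.sqrt S.card /
          (D.starNorm D.fullX * D.norm21 β)}

/-! ### The prior and the posterior -/

/-- `π_p` is a probability distribution on `{0, …, p}` with the ratio bounds. -/
structure IsSizePrior (A₁ A₂ A₃ A₄ : ℝ) (w : ℕ → ℝ) : Prop where
  nonneg : ∀ s ≤ D.p, 0 ≤ w s
  sum_eq_one : ∑ s ∈ Finset.range (D.p + 1), w s = 1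
  ratio : ∀ s, 1 ≤ s → s ≤ D.p →
    A₁ / (max (D.p : ℝ) ((n : ℝ) ^ D.maxGroupSize)) ^ A₃ ≤ w s / w (s - 1) ∧
    w s / w (s - 1) ≤ A₂ / (max (D.p : ℝ) ((n : ℝ) ^ D.maxGroupSize)) ^ A₄

/-- `λ = 8 ‖X‖_* √(log p ∨ ḡ log n)`. -/
def slabRate : ℝ := 8 * D.starNorm D.fullX * Real.sqrt D.logFactor

/-- The vector in `ℝ^d` with the coordinates `b` on the groups of `S` and `0` elsewhere. -/
def extend (S : Finset (Fin D.p)) (b : {k : Fin D.d // D.grp k ∈ S} → ℝ) : D.Coef :=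
  fun k => if h : D.grp k ∈ S then b ⟨k, h⟩ else 0

/-- The product-of-Kotz density `h_S` on `ℝ^{d_S}`. -/
def slab (S : Finset (Fin D.p)) (b : {k : Fin D.d // D.grp k ∈ S} → ℝ) : ℝ :=
  (D.slabRate / Real.sqrt Real.pi) ^ D.dimOf S *
    ((∏ j ∈ S, Real.Gamma ((D.groupSize j : ℝ) / 2)) /
      (2 ^ S.card * ∏ j ∈ S, Real.Gamma (D.groupSize j))) *
    Real.exp (-D.slabRate * D.norm21On S (D.extend S b))

/-- The prior of `β`: the mixture over `S` with weights `π_p(s) / (p choose s)` of the laws with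
`β_S` drawn from `h_S` and `β_{S^c} = 0`. -/
def prior (w : ℕ → ℝ) : MeasureTheory.Measure D.Coef :=
  ∑ S : Finset (Fin D.p), ENNReal.ofReal (w S.card / (D.p.choose S.card : ℝ)) •
    (MeasureTheory.volume.withDensity fun b => ENNReal.ofReal (D.slab S b)).map (D.extend S)

/-- The posterior probability of `B` given the response `z`, by Bayes' rule. -/
def posterior (w : ℕ → ℝ) (z : D.Response) (B : Set D.Coef) : ℝ≥0∞ :=
  (∫⁻ β in B, ENNReal.ofReal (D.lik β z) ∂(D.prior w)) /
    ∫⁻ β, ENNReal.ofReal (D.lik β z) ∂(D.prior w)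

/-- `E_0 Π(B | Y)`, the expectation of the posterior probability under the true parameter `β₀`. -/
def expectedPosterior (w : ℕ → ℝ) (β₀ : D.Coef) (B : Set D.Coef) : ℝ≥0∞ :=
  ∑ z, ENNReal.ofReal (D.lik β₀ z) * D.posterior w z B

/-- The set `ℬ₁(M)` of true parameters. -/
def trueSet (M : ℝ) : Set D.Coef :=
  {β₀ | (D.activeCount β₀ : ℝ) * Real.sqrt D.logFactor * (⨆ i, D.starNorm (D.X i)) ≤
    M * D.compat β₀ (D.activeGroups β₀) ^ 2 * D.starNorm D.fullX}

/-- The vectors `β` with `s_β > s_0 + (M₂ / A₄) (1 + 33 / φ²(S_0)) s_0`. -/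
def largeSet (A₄ M₂ : ℝ) (β₀ : D.Coef) : Set D.Coef :=
  {β | (D.activeCount β : ℝ) > D.activeCount β₀ +
    M₂ / A₄ * (1 + 33 / D.compat β₀ (D.activeGroups β₀) ^ 2) * D.activeCount β₀}

end LogitDesign

end

/-! Write `A` for `‖X‖_*`, `L` for `logFactor`, `q = √L`, `s₀` for the size of the truth and `φ` for
its compatibility number, so that `λ = 8Aq`. The logit model is an exponential family: the log
likelihood ratio at `β₀ + δ` is a linear score minus a sum of cumulant generating functions
(`lik_add`). The posterior mass of large models is a ratio of integrals, bounded separately above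
and below.

Upper bound. Each group of the score vector is sub-Gaussian with scale `A`, so outside an event of
vanishing probability all its group norms are at most `λ/4` (`sum_lik_not_scoreSmall_le`), and the
score costs at most `λ/4` times `‖δ‖_{2,1}`. The slab contributes `λ(‖β₀‖ - ‖β‖)`. If `δ` is off the
cone of the compatibility number, these terms and a further `λ/4 ‖δ‖` sum to at most `0`. On the
cone the cumulants compensate: they are bounded below by a multiple of the variance, which
compatibility bounds below by a quadratic in `‖δ‖`. The price is a factor `exp(95 s₀L/φ²)`
(`exponent_le`), and integrating the remaining `exp(-λ/4 ‖δ‖)` gives a model `S` the factor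
`4^{d_S}` (`lintegral_slab_mul_lik_le`).

Lower bound. Only the true model is kept, on the ball of radius `1/A` about `β₀`. There the
cumulants and the slab lose at most `1/2 + 8q` in the exponent, and the score averages out by
symmetry (`le_lintegral_slab_mul_lik`). The ball volume has a factorial in its denominator, which
costs at most `exp(s₀L/2)` because the condition on `β₀` forces `s₀q ≤ √n` (`factorial_div_pow_le`).

Balance. `k` groups beyond `s₀` gain about `exp(-A₄Lk)` from the dimension prior. The costs are `95
s₀L/φ²`, `s₀L` for the binomial coefficient, `s₀L/2` for the factorial, and terms of order `εLk`.
When `k` exceeds `(M₂/A₄)(1 + 33/φ²)s₀` with `M₂ > 3`, the gain wins, since `3·33 ≥ 95` and `3 >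
3/2` (`exp_term_le`); a geometric series remains. -/

noncomputable section

/-! ### Finite weighted sums -/

/-- Hoeffding's lemma for finitely many weights. -/
theorem sum_mul_exp_sub_mean_le {ι : Type*} [Fintype ι] (P a : ι → ℝ) (hP : ∀ c, 0 ≤ P c)
    (h1 : ∑ c, P c = 1) {r : ℝ} (ha : ∀ c, |a c| ≤ r) :
    ∑ c, P c * Real.exp (a c - ∑ c', P c' * a c') ≤ Real.exp (r ^ 2 / 2) := by
  classical
  let _ : MeasurableSpace ι := ⊤
  have : MeasurableSingletonClass ι := ⟨fun _ => trivial⟩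
  obtain ⟨c₀⟩ : Nonempty ι := by
    by_contra h
    rw [not_nonempty_iff] at h
    simp at h1
  have hr : 0 ≤ r := (abs_nonneg _).trans (ha c₀)
  let μ : MeasureTheory.Measure ι :=
    ∑ c, ENNReal.ofReal (P c) • MeasureTheory.Measure.dirac c
  have hint (f : ι → ℝ) : ∫ c, f c ∂μ = ∑ c, P c * f c := by
    rw [MeasureTheory.integral_finsetSum_measure]
    · refine Finset.sum_congr rfl fun c _ => ?_
      rw [MeasureTheory.integral_smul_measure, MeasureTheory.integral_dirac,
        ENNReal.toReal_ofReal (hP c), smul_eq_mul]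
    · intro c _
      exact (MeasureTheory.integrable_dirac (by simp)).smul_measure ENNReal.ofReal_ne_top
  have hprob : MeasureTheory.IsProbabilityMeasure μ := by
    constructor
    simp only [μ, MeasureTheory.Measure.coe_finsetSum, Finset.sum_apply,
      MeasureTheory.Measure.smul_apply, MeasureTheory.measure_univ, smul_eq_mul, mul_one]
    rw [← ENNReal.ofReal_sum_of_nonneg fun c _ => hP c, h1, ENNReal.ofReal_one]
  -- The variance proxy is the squared half-length of `[-r, r]`, that is `r²`; the claim is the
  -- bound at argument `1`.
  have hsub := ProbabilityTheory.hasSubgaussianMGF_of_mem_Icc (μ := μ) (X := a) (a := -r) (b := r)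
    (measurable_of_finite a).aemeasurable
    (Filter.Eventually.of_forall fun c => abs_le.1 (ha c))
  have h := hsub.mgf_le 1
  simp only [ProbabilityTheory.mgf, one_mul, hint] at h
  refine h.trans (Real.exp_le_exp.2 (le_of_eq ?_))
  simp only [sub_neg_eq_add, NNReal.coe_pow, NNReal.coe_div, coe_nnnorm, NNReal.coe_ofNat,
    Real.norm_eq_abs]
  rw [abs_of_nonneg (by linarith)]
  ring

/-- The cubic Taylor remainder is at most `(2/9)|u|³ ≤ u²/18` here, and `1/2 - 1/18 > 0.44`. -/
theorem exp_ge_quadratic {u : ℝ} (hu : |u| ≤ 1 / 4) : 1 + u + 0.44 * u ^ 2 ≤ Real.exp u := by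
  have h := Real.exp_bound (x := u) (by linarith) (n := 3) (by norm_num)
  simp [Finset.sum_range_succ, Nat.factorial] at h
  have h3 : |u| ^ 3 ≤ 1 / 4 * u ^ 2 := by
    rw [pow_succ, sq_abs, mul_comm]
    exact mul_le_mul_of_nonneg_right hu (sq_nonneg u)
  have := (abs_le.1 h).1
  nlinarith [sq_nonneg u]

/-- A lower bound for the cumulant generating function of a centred variable, through its convexity
and its expansion at a point `t` where the variable is small. -/
theorem log_sum_mul_exp_ge {ι : Type*} [Fintype ι] (P u : ι → ℝ) (hP : ∀ c, 0 ≤ P c)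
    (h1 : ∑ c, P c = 1) (hu : ∑ c, P c * u c = 0) {t : ℝ} (ht0 : 0 < t) (ht1 : t ≤ 1)
    (htu : ∀ c, t * |u c| ≤ 1 / 4) :
    t * (0.4 * ∑ c, P c * u c ^ 2) ≤ Real.log (∑ c, P c * Real.exp (u c)) := by
  have hpos : 0 < ∑ c, P c * Real.exp (u c) := by
    refine (Finset.sum_nonneg fun c _ =>
      mul_nonneg (hP c) (Real.exp_pos _).le).lt_of_ne' fun h => ?_
    rw [Finset.sum_eq_zero_iff_of_nonneg
      fun c _ => mul_nonneg (hP c) (Real.exp_pos _).le] at h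
    have : ∑ c, P c = 0 := Finset.sum_eq_zero fun c hc =>
      (mul_eq_zero.1 (h c hc)).resolve_right (Real.exp_pos _).ne'
    linarith
  set V := ∑ c, P c * u c ^ 2
  have hV0 : 0 ≤ V := Finset.sum_nonneg fun c _ => mul_nonneg (hP c) (sq_nonneg _)
  -- Jensen for the concave power `x ^ t` moves the problem from `u` to `t u`, which is small enough
  -- for the quadratic expansion.
  have hjen : ∑ c, P c * Real.exp (t * u c) ≤ (∑ c, P c * Real.exp (u c)) ^ t := by
    have := (Real.concaveOn_rpow ht0.le ht1).le_map_sum (t := Finset.univ) (w := P)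
      (p := fun c => Real.exp (u c)) (fun c _ => hP c) h1 (fun c _ => (Real.exp_pos _).le)
    simp only [smul_eq_mul, ← Real.exp_mul] at this
    simpa only [mul_comm t] using this
  have hquad : 1 + 0.44 * (t ^ 2 * V) ≤ ∑ c, P c * Real.exp (t * u c) := by
    calc 1 + 0.44 * (t ^ 2 * V) = ∑ c, P c * (1 + t * u c + 0.44 * (t * u c) ^ 2) := by
          simp only [mul_add, Finset.sum_add_distrib, mul_one, h1, V, Finset.mul_sum]
          have : ∑ c, P c * (t * u c) = 0 := by
            rw [← mul_zero t, ← hu, Finset.mul_sum]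
            exact Finset.sum_congr rfl fun c _ => by ring
          rw [this, add_zero]
          congr 1
          exact Finset.sum_congr rfl fun c _ => by ring
      _ ≤ _ := Finset.sum_le_sum fun c _ => mul_le_mul_of_nonneg_left
          (exp_ge_quadratic (by rw [abs_mul, abs_of_pos ht0]; exact htu c)) (hP c)
  have hVsmall : t ^ 2 * V ≤ 1 / 16 := by
    calc t ^ 2 * V = ∑ c, P c * (t * |u c|) ^ 2 := by
          simp only [V, Finset.mul_sum, mul_pow, sq_abs]
          exact Finset.sum_congr rfl fun c _ => by ring
      _ ≤ ∑ c, P c * (1 / 16) := Finset.sum_le_sum fun c _ => mul_le_mul_of_nonneg_left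
          (by nlinarith [htu c, mul_nonneg ht0.le (abs_nonneg (u c))]) (hP c)
      _ = 1 / 16 := by rw [← Finset.sum_mul, h1, one_mul]
  have hlog : 0.4 * (t ^ 2 * V) ≤ t * Real.log (∑ c, P c * Real.exp (u c)) := by
    rw [← Real.log_rpow hpos]
    have hy0 : 0 ≤ t ^ 2 * V := by positivity
    have h2 : 1 - (1 + 0.44 * (t ^ 2 * V))⁻¹ ≤ Real.log (1 + 0.44 * (t ^ 2 * V)) :=
      Real.one_sub_inv_le_log_of_pos (by positivity)
    -- With `t²V ≤ 1/16` the loss from `log(1 + x) ≥ x/(1 + x)` only lowers `0.44` to about `0.428`.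
    have h3 : 0.4 * (t ^ 2 * V) ≤ 1 - (1 + 0.44 * (t ^ 2 * V))⁻¹ := by
      have hp : 0 < 1 + 0.44 * (t ^ 2 * V) := by positivity
      rw [le_sub_iff_add_le, ← le_sub_iff_add_le', inv_le_iff_one_le_mul₀ hp]
      nlinarith
    exact h3.trans (h2.trans (Real.log_le_log (by positivity) (hquad.trans hjen)))
  have : t * (t * (0.4 * V)) ≤ t * Real.log (∑ c, P c * Real.exp (u c)) := by
    calc _ = 0.4 * (t ^ 2 * V) := by ring
      _ ≤ _ := hlog
  exact le_of_mul_le_mul_left this ht0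

theorem sum_pi_prod {ι κ : Type*} [Fintype ι] [DecidableEq ι] [Fintype κ] (f : ι → κ → ℝ) :
    ∑ z : ι → κ, ∏ i, f i (z i) = ∏ i, ∑ c, f i c := by
  rw [Finset.prod_univ_sum, Fintype.piFinset_univ]

/-- Expectation of a function of one coordinate under a product of finite distributions. -/
theorem sum_pi_prod_mul_apply {ι κ : Type*} [Fintype ι] [DecidableEq ι] [Fintype κ]
    (P : ι → κ → ℝ) (h1 : ∀ i, ∑ c, P i c = 1) (i : ι) (g : κ → ℝ) :
    ∑ z : ι → κ, (∏ k, P k (z k)) * g (z i) = ∑ c, P i c * g c := by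
  have h (z : ι → κ) : (∏ k, P k (z k)) * g (z i) =
      ∏ k, P k (z k) * (if k = i then g (z k) else 1) := by
    rw [Finset.prod_mul_distrib]
    simp
  simp_rw [h]
  rw [sum_pi_prod fun k c => P k c * (if k = i then g c else 1),
    Finset.prod_eq_single i (fun k _ hk => by simp [hk, h1]) (by simp)]
  simp

/-- Independent centred summands are uncorrelated: the variance of a sum. -/
theorem sum_pi_prod_mul_sum_sq {ι κ : Type*} [Fintype ι] [DecidableEq ι] [Fintype κ]
    (P : ι → κ → ℝ) (h1 : ∀ i, ∑ c, P i c = 1) (U : ι → κ → ℝ)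
    (hU : ∀ i, ∑ c, P i c * U i c = 0) :
    ∑ z : ι → κ, (∏ k, P k (z k)) * (∑ i, U i (z i)) ^ 2 = ∑ i, ∑ c, P i c * U i c ^ 2 := by
  have hcross (i j : ι) (hij : i ≠ j) :
      ∑ z : ι → κ, (∏ k, P k (z k)) * (U i (z i) * U j (z j)) = 0 := by
    have h (z : ι → κ) : (∏ k, P k (z k)) * (U i (z i) * U j (z j)) =
        ∏ k, P k (z k) * ((if k = i then U i (z k) else 1) * (if k = j then U j (z k) else 1)) := by
      rw [Finset.prod_mul_distrib, Finset.prod_mul_distrib]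
      simp
    simp_rw [h]
    rw [sum_pi_prod fun k c =>
      P k c * ((if k = i then U i c else 1) * (if k = j then U j c else 1))]
    exact Finset.prod_eq_zero (Finset.mem_univ i) (by simp [hij, hU])
  simp_rw [sq, Finset.sum_mul_sum, Finset.mul_sum]
  rw [Finset.sum_comm]
  refine Finset.sum_congr rfl fun i _ => ?_
  rw [Finset.sum_comm, Finset.sum_eq_single i (fun j _ hj => hcross i j hj.symm) (by simp)]
  exact sum_pi_prod_mul_apply P h1 i fun c => U i c * U i c

/-- Signs can be chosen such that the square norm of a signed sum is at most the sum of the square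
norms. -/
theorem exists_signs_norm_sum_sq_le {ι E : Type*} [NormedAddCommGroup E] [InnerProductSpace ℝ E]
    (S : Finset ι) (b : ι → E) :
    ∃ ε : ι → ℝ, (∀ i, |ε i| = 1) ∧ ‖∑ i ∈ S, ε i • b i‖ ^ 2 ≤ ∑ i ∈ S, ‖b i‖ ^ 2 := by
  classical
  induction S using Finset.induction_on with
  | empty => exact ⟨fun _ => 1, by simp⟩
  | insert j S hj ih =>
    obtain ⟨ε, hε, h⟩ := ih
    have hsum (c : ℝ) : ∑ i ∈ S, Function.update ε j c i • b i = ∑ i ∈ S, ε i • b i :=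
      Finset.sum_congr rfl fun i hi => by
        rw [Function.update_of_ne (ne_of_mem_of_not_mem hi hj)]
    have hupd (c : ℝ) (hc : |c| = 1) (i : ι) : |Function.update ε j c i| = 1 := by
      by_cases hi : i = j
      · subst hi; simpa using hc
      · simpa [hi] using hε i
    set x := ∑ i ∈ S, ε i • b i
    -- The shorter of `b j ± x` has square norm at most `‖b j‖² + ‖x‖²`.
    have hpar := parallelogram_law_with_norm ℝ (b j) x
    rcases le_total ‖b j + x‖ ‖b j - x‖ with hle | hle
    · refine ⟨Function.update ε j 1, hupd 1 (by simp), ?_⟩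
      rw [Finset.sum_insert hj, Finset.sum_insert hj, hsum, Function.update_self, one_smul]
      nlinarith [norm_nonneg (b j + x), norm_nonneg (b j - x)]
    · refine ⟨Function.update ε j (-1), hupd (-1) (by simp), ?_⟩
      rw [Finset.sum_insert hj, Finset.sum_insert hj, hsum, Function.update_self, neg_one_smul]
      have : ‖-b j + x‖ = ‖b j - x‖ := by rw [← norm_neg]; congr 1; abel
      rw [this]
      nlinarith [norm_nonneg (b j + x), norm_nonneg (b j - x)]

/-! ### Gaussian integrals and sub-Gaussian vectors -/

theorem integral_exp_linear_sub_sq (b : ℝ) :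
    ∫ x : ℝ, Real.exp (b * x - x ^ 2 / 2) = Real.sqrt (2 * Real.pi) * Real.exp (b ^ 2 / 2) := by
  have h (x : ℝ) : Real.exp (b * x - x ^ 2 / 2) =
      Real.exp (-(1 / 2) * (x - b) ^ 2) * Real.exp (b ^ 2 / 2) := by
    rw [← Real.exp_add]
    congr 1
    ring
  simp_rw [h]
  rw [MeasureTheory.integral_mul_const,
    MeasureTheory.integral_sub_right_eq_self (fun x => Real.exp (-(1 / 2) * x ^ 2)) b,
    integral_gaussian]
  congr 2
  ring

theorem integrable_exp_linear_sub_sq (b : ℝ) :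
    MeasureTheory.Integrable fun x : ℝ => Real.exp (b * x - x ^ 2 / 2) := by
  refine MeasureTheory.Integrable.of_integral_ne_zero ?_
  rw [integral_exp_linear_sub_sq]
  positivity

/-- A sub-Gaussian vector has exponential moments of its square norm: integrate the bound for the
linear functionals against a Gaussian law of the functional. -/
theorem sum_mul_exp_sq_le {Z κ : Type*} [Fintype Z] [Fintype κ] (P : Z → ℝ)
    (v : Z → κ → ℝ) {B : ℝ} (hB : 0 < B)
    (h : ∀ g : κ → ℝ, ∑ z, P z * Real.exp (∑ k, v z k * g k) ≤
      Real.exp (B ^ 2 / 2 * ∑ k, g k ^ 2)) :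
    ∑ z, P z * Real.exp (3 / 8 * (∑ k, v z k ^ 2) / B ^ 2) ≤ 2 ^ Fintype.card κ := by
  -- With `t²B² = 3/4` the Gaussian weight `exp(-g²/2)` weakens to `exp(-g²/8)`, whose integral is
  -- exactly twice the original one per coordinate.
  set t := Real.sqrt (3 / 4) / B with ht
  have ht2 : t ^ 2 = 3 / 4 / B ^ 2 := by
    rw [ht, div_pow, Real.sq_sqrt (by norm_num)]
  let G : Z → (κ → ℝ) → ℝ := fun z g => ∏ k, Real.exp (t * v z k * g k - g k ^ 2 / 2)
  have hGint (z : Z) : MeasureTheory.Integrable (G z) :=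
    MeasureTheory.Integrable.fintype_prod (f := fun k x => Real.exp (t * v z k * x - x ^ 2 / 2))
      fun k => integrable_exp_linear_sub_sq _
  have hG (z : Z) : ∫ g, G z g = Real.sqrt (2 * Real.pi) ^ Fintype.card κ *
      Real.exp (3 / 8 * (∑ k, v z k ^ 2) / B ^ 2) := by
    rw [MeasureTheory.integral_fintype_prod_volume_eq_prod
      fun k x => Real.exp (t * v z k * x - x ^ 2 / 2)]
    simp_rw [integral_exp_linear_sub_sq]
    rw [Finset.prod_mul_distrib, Finset.prod_const, Finset.card_univ, ← Real.exp_sum]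
    congr 2
    rw [Finset.mul_sum, Finset.sum_div]
    refine Finset.sum_congr rfl fun k _ => ?_
    rw [mul_pow, ht2]
    ring
  have hpt (g : κ → ℝ) : ∑ z, P z * G z g ≤ ∏ k, Real.exp (-(1 / 8) * g k ^ 2) := by
    have h1 : ∑ z, P z * G z g = (∑ z, P z * Real.exp (∑ k, v z k * (t * g k))) *
        Real.exp (-(∑ k, g k ^ 2) / 2) := by
      rw [Finset.sum_mul]
      refine Finset.sum_congr rfl fun z _ => ?_
      simp only [G]
      rw [mul_assoc, ← Real.exp_add, ← Real.exp_sum]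
      congr 2
      rw [Finset.sum_sub_distrib, ← Finset.sum_div, sub_eq_add_neg, neg_div]
      congr 1
      exact Finset.sum_congr rfl fun k _ => by ring
    rw [h1]
    refine (mul_le_mul_of_nonneg_right (h fun k => t * g k) (Real.exp_pos _).le).trans
      (le_of_eq ?_)
    rw [← Real.exp_add, ← Real.exp_sum]
    congr 1
    simp only [mul_pow, ht2]
    rw [← Finset.mul_sum, ← Finset.mul_sum]
    field_simp
    ring
  have hint : ∫ g : κ → ℝ, ∑ z, P z * G z g ≤ ∫ g : κ → ℝ, ∏ k, Real.exp (-(1 / 8) * g k ^ 2) :=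
    MeasureTheory.integral_mono
      (MeasureTheory.integrable_finsetSum _ fun z _ => (hGint z).const_mul _)
      (MeasureTheory.Integrable.fintype_prod (f := fun _ x => Real.exp (-(1 / 8) * x ^ 2))
        fun _ => integrable_exp_neg_mul_sq (by norm_num)) hpt
  rw [MeasureTheory.integral_finsetSum _ fun z _ => (hGint z).const_mul _,
    MeasureTheory.integral_fintype_prod_volume_eq_pow fun x => Real.exp (-(1 / 8) * x ^ 2),
    integral_gaussian] at hint
  simp_rw [MeasureTheory.integral_const_mul, hG, mul_left_comm (P _)] at hint
  have h4 : Real.sqrt (Real.pi / (1 / 8)) = 2 * Real.sqrt (2 * Real.pi) := by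
    rw [show Real.pi / (1 / 8) = 2 ^ 2 * (2 * Real.pi) by ring,
      Real.sqrt_mul (by norm_num), Real.sqrt_sq (by norm_num)]
  rw [← Finset.mul_sum, h4, mul_pow, mul_comm] at hint
  exact le_of_mul_le_mul_right hint (by positivity)

/-! ### Euclidean and spectral norms -/

section Norms

variable {ι κ : Type*} [Fintype ι] [Fintype κ]

theorem l2norm_sq (v : ι → ℝ) : l2norm v ^ 2 = ∑ i, v i ^ 2 := by
  rw [l2norm, EuclideanSpace.norm_sq_eq]
  simp

theorem l2norm_nonneg (v : ι → ℝ) : 0 ≤ l2norm v := norm_nonneg _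

theorem l2norm_add_le (v w : ι → ℝ) : l2norm (v + w) ≤ l2norm v + l2norm w := by
  rw [l2norm, WithLp.toLp_add]
  exact norm_add_le _ _

theorem l2norm_smul (c : ℝ) (v : ι → ℝ) : l2norm (c • v) = |c| * l2norm v := by
  rw [l2norm, WithLp.toLp_smul, norm_smul, Real.norm_eq_abs, l2norm]

theorem l2norm_eq_zero {v : ι → ℝ} : l2norm v = 0 ↔ v = 0 := by
  rw [l2norm, norm_eq_zero, WithLp.toLp_eq_zero]

theorem l2norm_sum_le {α : Type*} (s : Finset α) (f : α → ι → ℝ) :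
    l2norm (∑ a ∈ s, f a) ≤ ∑ a ∈ s, l2norm (f a) := by
  simp only [l2norm, WithLp.toLp_sum]
  exact norm_sum_le _ _

theorem abs_apply_le_l2norm (v : ι → ℝ) (i : ι) : |v i| ≤ l2norm v := by
  refine abs_le_of_sq_le_sq ?_ (l2norm_nonneg v)
  rw [l2norm_sq]
  exact Finset.single_le_sum (f := fun i => v i ^ 2) (fun _ _ => sq_nonneg _) (Finset.mem_univ i)

theorem sum_mul_le_l2norm_mul (v w : ι → ℝ) : ∑ i, v i * w i ≤ l2norm v * l2norm w := by
  refine (Real.sum_mul_le_sqrt_mul_sqrt Finset.univ v w).trans (le_of_eq ?_)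
  rw [← l2norm_sq, ← l2norm_sq, Real.sqrt_sq (l2norm_nonneg v), Real.sqrt_sq (l2norm_nonneg w)]

variable [DecidableEq κ]

theorem specNorm_nonneg (A : Matrix ι κ ℝ) : 0 ≤ specNorm A := norm_nonneg _

theorem l2norm_mulVec_le (A : Matrix ι κ ℝ) (v : κ → ℝ) :
    l2norm (A *ᵥ v) ≤ specNorm A * l2norm v := by
  have h := (Matrix.toEuclideanLin A).toContinuousLinearMap.le_opNorm (WithLp.toLp 2 v)
  simpa [specNorm, l2norm, Matrix.toLpLin_toLp] using h

theorem specNorm_le {A : Matrix ι κ ℝ} {M : ℝ} (hM : 0 ≤ M)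
    (h : ∀ v, l2norm (A *ᵥ v) ≤ M * l2norm v) : specNorm A ≤ M := by
  refine ContinuousLinearMap.opNorm_le_bound _ hM fun v => ?_
  have := h v.ofLp
  simpa [l2norm, Matrix.toLpLin_apply] using this

end Norms

namespace LogitDesign

variable {n : ℕ} (D : LogitDesign n)

/-! ### Group norms -/

theorem groupNorm_nonneg (β : D.Coef) (j : Fin D.p) : 0 ≤ D.groupNorm β j := l2norm_nonneg _

theorem groupNorm_sq (β : D.Coef) (j : Fin D.p) :
    D.groupNorm β j ^ 2 = ∑ k : {k : Fin D.d // D.grp k = j}, β k ^ 2 := l2norm_sq _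

theorem groupNorm_add_le (β γ : D.Coef) (j : Fin D.p) :
    D.groupNorm (β + γ) j ≤ D.groupNorm β j + D.groupNorm γ j := l2norm_add_le _ _

theorem groupNorm_smul (c : ℝ) (β : D.Coef) (j : Fin D.p) :
    D.groupNorm (c • β) j = |c| * D.groupNorm β j := l2norm_smul c _

theorem groupNorm_neg (β : D.Coef) (j : Fin D.p) : D.groupNorm (-β) j = D.groupNorm β j := by
  rw [← neg_one_smul ℝ, groupNorm_smul]
  simp

theorem groupNorm_eq_zero {β : D.Coef} {j : Fin D.p} :
    D.groupNorm β j = 0 ↔ ∀ k, D.grp k = j → β k = 0 := by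
  rw [groupNorm, l2norm_eq_zero, funext_iff, Subtype.forall]
  rfl

theorem groupNorm_congr {β γ : D.Coef} {j : Fin D.p} (h : ∀ k, D.grp k = j → β k = γ k) :
    D.groupNorm β j = D.groupNorm γ j := by
  unfold groupNorm
  congr 1
  exact funext fun k => h k k.2

theorem groupNorm_eq_zero_of_notMem {β : D.Coef} {j : Fin D.p} (h : j ∉ D.activeGroups β) :
    D.groupNorm β j = 0 := by
  rw [groupNorm_eq_zero]
  intro k hk
  by_contra hne
  exact h (Finset.mem_filter.2 ⟨Finset.mem_univ _, k, hk, hne⟩)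

theorem norm21On_nonneg (S : Finset (Fin D.p)) (β : D.Coef) : 0 ≤ D.norm21On S β :=
  Finset.sum_nonneg fun j _ => D.groupNorm_nonneg β j

theorem norm21_nonneg (β : D.Coef) : 0 ≤ D.norm21 β := D.norm21On_nonneg _ β

theorem norm21On_add_compl (S : Finset (Fin D.p)) (β : D.Coef) :
    D.norm21On S β + D.norm21On Sᶜ β = D.norm21 β := Finset.sum_add_sum_compl S _

theorem norm21On_add_le (S : Finset (Fin D.p)) (β γ : D.Coef) :
    D.norm21On S (β + γ) ≤ D.norm21On S β + D.norm21On S γ := by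
  unfold norm21On
  rw [← Finset.sum_add_distrib]
  exact Finset.sum_le_sum fun j _ => D.groupNorm_add_le β γ j

theorem norm21On_smul (S : Finset (Fin D.p)) (c : ℝ) (β : D.Coef) :
    D.norm21On S (c • β) = |c| * D.norm21On S β := by
  simp only [norm21On, groupNorm_smul, Finset.mul_sum]

theorem norm21On_neg (S : Finset (Fin D.p)) (β : D.Coef) :
    D.norm21On S (-β) = D.norm21On S β := by
  simp only [norm21On, groupNorm_neg]

/-- The vector that agrees with `β` on the group `j` and vanishes on the other groups. -/
def groupPart (j : Fin D.p) (β : D.Coef) : D.Coef := fun k => if D.grp k = j then β k else 0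

theorem sum_groupPart (β : D.Coef) : ∑ j, D.groupPart j β = β := by
  ext k
  simp [groupPart, Finset.sum_apply]

theorem mulVec_groupPart {ι : Type*} [Fintype ι] (A : Matrix ι (Fin D.d) ℝ) (j : Fin D.p)
    (β : D.Coef) :
    A *ᵥ D.groupPart j β =
      (A.submatrix id fun k : {k : Fin D.d // D.grp k = j} => (k : Fin D.d)) *ᵥ
        fun k : {k : Fin D.d // D.grp k = j} => β k := by
  ext i
  simp only [Matrix.mulVec, dotProduct, groupPart, mul_ite, mul_zero, Matrix.submatrix_apply, id]
  rw [← Finset.sum_filter]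
  exact Finset.sum_subtype _ (by simp) fun k => A i k * β k

theorem specNorm_le_starNorm {ι : Type*} [Fintype ι] (A : Matrix ι (Fin D.d) ℝ) (j : Fin D.p) :
    specNorm (A.submatrix id fun k : {k : Fin D.d // D.grp k = j} => (k : Fin D.d)) ≤
      D.starNorm A :=
  le_ciSup (f := fun j : Fin D.p =>
    specNorm (A.submatrix id fun k : {k : Fin D.d // D.grp k = j} => (k : Fin D.d)))
    (Set.finite_range _).bddAbove j

theorem starNorm_nonneg {ι : Type*} [Fintype ι] (A : Matrix ι (Fin D.d) ℝ) :
    0 ≤ D.starNorm A := Real.iSup_nonneg fun _ => specNorm_nonneg _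

theorem l2norm_mulVec_groupPart_le {ι : Type*} [Fintype ι] (A : Matrix ι (Fin D.d) ℝ)
    (j : Fin D.p) (β : D.Coef) :
    l2norm (A *ᵥ D.groupPart j β) ≤ D.starNorm A * D.groupNorm β j := by
  rw [mulVec_groupPart]
  exact (l2norm_mulVec_le _ _).trans
    (mul_le_mul_of_nonneg_right (D.specNorm_le_starNorm A j) (l2norm_nonneg _))

theorem l2norm_mulVec_le_norm21 {ι : Type*} [Fintype ι] (A : Matrix ι (Fin D.d) ℝ)
    (β : D.Coef) : l2norm (A *ᵥ β) ≤ D.starNorm A * D.norm21 β := by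
  calc l2norm (A *ᵥ β) = l2norm (∑ j, A *ᵥ D.groupPart j β) := by
        rw [← Matrix.mulVec_sum, sum_groupPart]
    _ ≤ ∑ j, l2norm (A *ᵥ D.groupPart j β) := l2norm_sum_le _ _
    _ ≤ ∑ j, D.starNorm A * D.groupNorm β j :=
        Finset.sum_le_sum fun j _ => D.l2norm_mulVec_groupPart_le A j β
    _ = _ := by rw [norm21, Finset.mul_sum]

theorem starNorm_pos {ι : Type*} [Fintype ι] {A : Matrix ι (Fin D.d) ℝ} (hA : A ≠ 0) :
    0 < D.starNorm A := by
  refine (D.starNorm_nonneg A).lt_of_ne' fun h => hA ?_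
  refine Matrix.ext_of_mulVec_single fun k => ?_
  have := D.l2norm_mulVec_le_norm21 A (Pi.single k 1)
  rw [h, zero_mul] at this
  rw [Matrix.zero_mulVec]
  exact l2norm_eq_zero.1 (le_antisymm this (l2norm_nonneg _))

/-- `max_i ‖X_i‖_*`. -/
def maxStarNorm : ℝ := ⨆ i, D.starNorm (D.X i)

theorem starNorm_le_maxStarNorm (i : Fin n) : D.starNorm (D.X i) ≤ D.maxStarNorm :=
  le_ciSup (f := fun i => D.starNorm (D.X i)) (Set.finite_range _).bddAbove i

theorem maxStarNorm_nonneg : 0 ≤ D.maxStarNorm := Real.iSup_nonneg fun _ => D.starNorm_nonneg _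

theorem fullX_mulVec (β : D.Coef) (a : Fin n × Fin D.r) :
    (D.fullX *ᵥ β) a = (D.X a.1 *ᵥ β) a.2 := rfl

theorem l2norm_fullX_mulVec_sq (β : D.Coef) :
    l2norm (D.fullX *ᵥ β) ^ 2 = ∑ i, l2norm (D.X i *ᵥ β) ^ 2 := by
  simp only [l2norm_sq, Fintype.sum_prod_type, fullX_mulVec]

/-- The square norms of the `n` blocks add up, whence `√n`. -/
theorem starNorm_fullX_le : D.starNorm D.fullX ≤ Real.sqrt n * D.maxStarNorm := by
  have hM := D.maxStarNorm_nonneg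
  refine Real.iSup_le (fun j => specNorm_le (by positivity) fun v => ?_) (by positivity)
  let β : D.Coef := fun k => if h : D.grp k = j then v ⟨k, h⟩ else 0
  have hβ : (fun k : {k : Fin D.d // D.grp k = j} => β k) = v := by
    ext k
    simp [β, k.2]
  have hmul : ∀ i, l2norm (D.X i *ᵥ D.groupPart j β) ≤ D.maxStarNorm * l2norm v := fun i => by
    refine (D.l2norm_mulVec_groupPart_le (D.X i) j β).trans ?_
    rw [groupNorm, hβ]
    exact mul_le_mul_of_nonneg_right (D.starNorm_le_maxStarNorm i) (l2norm_nonneg _)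
  have hv := l2norm_nonneg v
  rw [← hβ, ← mulVec_groupPart, hβ]
  refine abs_le_of_sq_le_sq' ?_ (by positivity) |>.2
  rw [l2norm_fullX_mulVec_sq]
  calc ∑ i, l2norm (D.X i *ᵥ D.groupPart j β) ^ 2 ≤ ∑ _i : Fin n, (D.maxStarNorm * l2norm v) ^ 2 :=
        Finset.sum_le_sum fun i _ => pow_le_pow_left₀ (l2norm_nonneg _) (hmul i) 2
    _ = _ := by
        rw [Finset.sum_const, Finset.card_univ, Fintype.card_fin, nsmul_eq_mul, mul_assoc,
          mul_pow (Real.sqrt n), Real.sq_sqrt (Nat.cast_nonneg n)]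

theorem fullX_ne_zero (hX : D.X ≠ 0) : D.fullX ≠ 0 := fun h => hX <| by
  ext i l k
  exact congr_fun (congr_fun h (i, l)) k

/-! ### The likelihood ratio -/

/-- The linear predictor of the category `c`, which is `0` for the reference category. -/
def catLin (β : D.Coef) (i : Fin n) (c : Fin (D.r + 1)) : ℝ :=
  Fin.cases (motive := fun _ => ℝ) 0 (fun l => (D.X i *ᵥ β) l) c

theorem catLin_zero_right (β : D.Coef) (i : Fin n) : D.catLin β i 0 = 0 := rfl

theorem catLin_succ (β : D.Coef) (i : Fin n) (l : Fin D.r) :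
    D.catLin β i l.succ = (D.X i *ᵥ β) l := rfl

theorem catLin_add (β γ : D.Coef) (i : Fin n) (c : Fin (D.r + 1)) :
    D.catLin (β + γ) i c = D.catLin β i c + D.catLin γ i c := by
  refine Fin.cases ?_ (fun l => ?_) c
  · simp [catLin_zero_right]
  · simp [catLin_succ, Matrix.mulVec_add]

theorem catLin_neg (β : D.Coef) (i : Fin n) (c : Fin (D.r + 1)) :
    D.catLin (-β) i c = -D.catLin β i c := by
  refine Fin.cases ?_ (fun l => ?_) c
  · simp [catLin_zero_right]
  · simp [catLin_succ, Matrix.mulVec_neg]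

theorem abs_catLin_le (β : D.Coef) (i : Fin n) (c : Fin (D.r + 1)) :
    |D.catLin β i c| ≤ l2norm (D.X i *ᵥ β) := by
  refine Fin.cases ?_ (fun l => ?_) c
  · simpa [catLin_zero_right] using l2norm_nonneg _
  · exact abs_apply_le_l2norm (D.X i *ᵥ β) l

theorem catProb_eq (β : D.Coef) (i : Fin n) (c : Fin (D.r + 1)) :
    D.catProb β i c = Real.exp (D.catLin β i c) / ∑ c', Real.exp (D.catLin β i c') := by
  rw [catProb, Fin.sum_univ_succ, catLin_zero_right, Real.exp_zero]
  congr 1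
  refine Fin.cases ?_ (fun l => ?_) c
  · simp [catLin_zero_right]
  · simp [catLin_succ]

theorem sum_exp_pos {ι : Type*} [Fintype ι] [Nonempty ι] (f : ι → ℝ) :
    0 < ∑ c, Real.exp (f c) :=
  Finset.sum_pos (fun _ _ => Real.exp_pos _) Finset.univ_nonempty

theorem catProb_pos (β : D.Coef) (i : Fin n) (c : Fin (D.r + 1)) : 0 < D.catProb β i c := by
  rw [catProb_eq]
  exact div_pos (Real.exp_pos _) (sum_exp_pos _)

theorem sum_catProb (β : D.Coef) (i : Fin n) : ∑ c, D.catProb β i c = 1 := by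
  simp_rw [catProb_eq]
  rw [← Finset.sum_div, div_self (sum_exp_pos _).ne']

theorem lik_pos (β : D.Coef) (z : D.Response) : 0 < D.lik β z :=
  Finset.prod_pos fun i _ => D.catProb_pos β i (z i)

theorem sum_lik (β : D.Coef) : ∑ z, D.lik β z = 1 := by
  unfold lik
  rw [sum_pi_prod]
  simp [sum_catProb]

/-- The mean of the linear predictor of `δ` at the response of the individual `i`. -/
def catMean (β₀ δ : D.Coef) (i : Fin n) : ℝ := ∑ c, D.catProb β₀ i c * D.catLin δ i c

/-- The variance of the linear predictor of `δ` at the response of the individual `i`. -/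
def catVar (β₀ δ : D.Coef) (i : Fin n) : ℝ :=
  ∑ c, D.catProb β₀ i c * (D.catLin δ i c - D.catMean β₀ δ i) ^ 2

/-- The cumulant generating function of the centred linear predictor of `δ` at the response of the
individual `i`. -/
def cumul (β₀ δ : D.Coef) (i : Fin n) : ℝ :=
  Real.log (∑ c, D.catProb β₀ i c * Real.exp (D.catLin δ i c - D.catMean β₀ δ i))

/-- The score `(Y - μ)ᵀ X δ`. -/
def score (β₀ : D.Coef) (z : D.Response) (δ : D.Coef) : ℝ :=
  ∑ i, (D.catLin δ i (z i) - D.catMean β₀ δ i)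

theorem sum_catProb_mul_exp_pos (β₀ δ : D.Coef) (i : Fin n) :
    0 < ∑ c, D.catProb β₀ i c * Real.exp (D.catLin δ i c - D.catMean β₀ δ i) :=
  Finset.sum_pos (fun c _ => mul_pos (D.catProb_pos β₀ i c) (Real.exp_pos _))
    Finset.univ_nonempty

theorem catProb_add (β₀ δ : D.Coef) (i : Fin n) (c : Fin (D.r + 1)) :
    D.catProb (β₀ + δ) i c = D.catProb β₀ i c *
      Real.exp (D.catLin δ i c - D.catMean β₀ δ i - D.cumul β₀ δ i) := by
  rw [Real.exp_sub _ (D.cumul β₀ δ i), cumul, Real.exp_log (D.sum_catProb_mul_exp_pos β₀ δ i)]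
  have h0 := sum_exp_pos fun c => D.catLin β₀ i c
  have h1 := sum_exp_pos fun c => D.catLin (β₀ + δ) i c
  have hs : ∑ c, D.catProb β₀ i c * Real.exp (D.catLin δ i c - D.catMean β₀ δ i) =
      (∑ c, Real.exp (D.catLin (β₀ + δ) i c)) / (∑ c, Real.exp (D.catLin β₀ i c)) *
        Real.exp (-D.catMean β₀ δ i) := by
    rw [Finset.sum_div, Finset.sum_mul]
    refine Finset.sum_congr rfl fun c _ => ?_
    rw [catProb_eq, catLin_add, Real.exp_add, sub_eq_add_neg, Real.exp_add]
    ring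
  rw [hs, catProb_eq, catProb_eq, sub_eq_add_neg, Real.exp_add, catLin_add, Real.exp_add]
  have := Real.exp_pos (-D.catMean β₀ δ i)
  simp only [catLin_add, Real.exp_add] at h1 ⊢
  field_simp

/-- Exponential family form. The response enters only through the linear score; the cumulants are
deterministic. -/
theorem lik_add (β₀ δ : D.Coef) (z : D.Response) :
    D.lik (β₀ + δ) z = D.lik β₀ z * Real.exp (D.score β₀ z δ - ∑ i, D.cumul β₀ δ i) := by
  unfold lik score
  rw [← Finset.sum_sub_distrib, Real.exp_sum, ← Finset.prod_mul_distrib]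
  exact Finset.prod_congr rfl fun i _ => D.catProb_add β₀ δ i (z i)

theorem catMean_neg (β₀ δ : D.Coef) (i : Fin n) :
    D.catMean β₀ (-δ) i = -D.catMean β₀ δ i := by
  simp [catMean, catLin_neg]

theorem score_neg (β₀ : D.Coef) (z : D.Response) (δ : D.Coef) :
    D.score β₀ z (-δ) = -D.score β₀ z δ := by
  simp only [score, catLin_neg, catMean_neg, ← Finset.sum_neg_distrib]
  exact Finset.sum_congr rfl fun i _ => by ring

theorem sum_catProb_mul_sub_catMean (β₀ δ : D.Coef) (i : Fin n) :
    ∑ c, D.catProb β₀ i c * (D.catLin δ i c - D.catMean β₀ δ i) = 0 := by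
  simp only [mul_sub, Finset.sum_sub_distrib, ← Finset.sum_mul, sum_catProb, one_mul]
  rw [catMean, sub_self]

/-- Hoeffding for each individual, since each linear predictor is bounded by the Euclidean norm of
`X_i δ`. This serves both the sub-Gaussianity of the score and the likelihood near `β₀`. -/
theorem sum_cumul_le (β₀ δ : D.Coef) :
    ∑ i, D.cumul β₀ δ i ≤ l2norm (D.fullX *ᵥ δ) ^ 2 / 2 := by
  rw [l2norm_fullX_mulVec_sq, Finset.sum_div]
  refine Finset.sum_le_sum fun i _ => ?_
  rw [cumul, Real.log_le_iff_le_exp (D.sum_catProb_mul_exp_pos β₀ δ i)]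
  exact sum_mul_exp_sub_mean_le _ _ (fun c => (D.catProb_pos β₀ i c).le) (D.sum_catProb β₀ i)
    (D.abs_catLin_le δ i)

theorem abs_catMean_le (β₀ δ : D.Coef) (i : Fin n) :
    |D.catMean β₀ δ i| ≤ l2norm (D.X i *ᵥ δ) := by
  calc |D.catMean β₀ δ i| ≤ ∑ c, |D.catProb β₀ i c * D.catLin δ i c| :=
        Finset.abs_sum_le_sum_abs _ _
    _ ≤ ∑ c, D.catProb β₀ i c * l2norm (D.X i *ᵥ δ) := by
        refine Finset.sum_le_sum fun c _ => ?_
        rw [abs_mul, abs_of_pos (D.catProb_pos β₀ i c)]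
        exact mul_le_mul_of_nonneg_left (D.abs_catLin_le δ i c) (D.catProb_pos β₀ i c).le
    _ = _ := by rw [← Finset.sum_mul, sum_catProb, one_mul]

/-- The centred predictors are at most twice `maxStarNorm` times `‖δ‖_{2,1}`. The free factor `t`
may shrink as `δ` grows, so the bound needs no localisation of `δ`; far from `0` it degrades from
quadratic to linear growth. -/
theorem le_sum_cumul (β₀ δ : D.Coef) {t : ℝ} (ht0 : 0 < t) (ht1 : t ≤ 1)
    (ht : t * (2 * (D.maxStarNorm * D.norm21 δ)) ≤ 1 / 4) :
    t * (0.4 * ∑ i, D.catVar β₀ δ i) ≤ ∑ i, D.cumul β₀ δ i := by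
  rw [Finset.mul_sum, Finset.mul_sum]
  refine Finset.sum_le_sum fun i _ => ?_
  refine log_sum_mul_exp_ge _ _ (fun c => (D.catProb_pos β₀ i c).le) (D.sum_catProb β₀ i)
    (D.sum_catProb_mul_sub_catMean β₀ δ i) ht0 ht1 fun c => ?_
  refine (mul_le_mul_of_nonneg_left ?_ ht0.le).trans ht
  have hX : l2norm (D.X i *ᵥ δ) ≤ D.maxStarNorm * D.norm21 δ :=
    (D.l2norm_mulVec_le_norm21 (D.X i) δ).trans
      (mul_le_mul_of_nonneg_right (D.starNorm_le_maxStarNorm i) (D.norm21_nonneg δ))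
  linarith [abs_sub (D.catLin δ i c) (D.catMean β₀ δ i), D.abs_catLin_le δ i c,
    D.abs_catMean_le β₀ δ i]

theorem catVar_le (β₀ δ : D.Coef) (i : Fin n) :
    D.catVar β₀ δ i ≤ l2norm (D.X i *ᵥ δ) ^ 2 := by
  have h : D.catVar β₀ δ i = ∑ c, D.catProb β₀ i c * D.catLin δ i c ^ 2 -
      D.catMean β₀ δ i ^ 2 := by
    have h1 : ∀ c, D.catProb β₀ i c * (D.catLin δ i c - D.catMean β₀ δ i) ^ 2 =
        D.catProb β₀ i c * D.catLin δ i c ^ 2 -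
          2 * D.catMean β₀ δ i * (D.catProb β₀ i c * D.catLin δ i c) +
          D.catMean β₀ δ i ^ 2 * D.catProb β₀ i c := fun c => by ring
    rw [catVar, Finset.sum_congr rfl fun c _ => h1 c, Finset.sum_add_distrib,
      Finset.sum_sub_distrib, ← Finset.mul_sum, ← Finset.mul_sum, sum_catProb]
    rw [← catMean]
    ring
  have h2 : ∑ c, D.catProb β₀ i c * D.catLin δ i c ^ 2 ≤ l2norm (D.X i *ᵥ δ) ^ 2 := by
    calc _ ≤ ∑ c, D.catProb β₀ i c * l2norm (D.X i *ᵥ δ) ^ 2 :=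
          Finset.sum_le_sum fun c _ => mul_le_mul_of_nonneg_left
            (sq_le_sq.2 ((D.abs_catLin_le δ i c).trans (le_abs_self _)))
            (D.catProb_pos β₀ i c).le
      _ = _ := by rw [← Finset.sum_mul, sum_catProb, one_mul]
  nlinarith [sq_nonneg (D.catMean β₀ δ i)]

/-! ### The covariance matrix and the score vector -/

theorem sum_indic_mul (z : D.Response) (δ : D.Coef) :
    ∑ a, D.indic z a * (D.fullX *ᵥ δ) a = ∑ i, D.catLin δ i (z i) := by
  rw [Fintype.sum_prod_type]
  refine Finset.sum_congr rfl fun i _ => ?_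
  simp only [indic, fullX_mulVec]
  rcases Fin.eq_zero_or_eq_succ (z i) with h | ⟨l, h⟩
  · simp [h, catLin_zero_right, (Fin.succ_ne_zero _).symm]
  · rw [Finset.sum_eq_single l] <;> simp +contextual [h, catLin_succ, eq_comm]

theorem sum_meanY_mul (β₀ δ : D.Coef) :
    ∑ a, D.meanY β₀ a * (D.fullX *ᵥ δ) a = ∑ i, D.catMean β₀ δ i := by
  simp only [meanY, Finset.sum_mul]
  rw [Finset.sum_comm]
  simp only [mul_assoc, ← Finset.mul_sum, sum_indic_mul]
  simp only [Finset.mul_sum]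
  rw [Finset.sum_comm]
  exact Finset.sum_congr rfl fun i _ =>
    sum_pi_prod_mul_apply (fun i c => D.catProb β₀ i c) (D.sum_catProb β₀) i
      fun c => D.catLin δ i c

theorem score_eq_sum (β₀ : D.Coef) (z : D.Response) (δ : D.Coef) :
    D.score β₀ z δ = ∑ a, (D.indic z a - D.meanY β₀ a) * (D.fullX *ᵥ δ) a := by
  simp only [sub_mul, Finset.sum_sub_distrib, sum_indic_mul, sum_meanY_mul, score]

/-- The score vector `Xᵀ (Y - μ)`. -/
def scoreVec (β₀ : D.Coef) (z : D.Response) : D.Coef :=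
  fun k => ∑ a, (D.indic z a - D.meanY β₀ a) * D.fullX a k

theorem score_eq_sum_scoreVec (β₀ : D.Coef) (z : D.Response) (δ : D.Coef) :
    D.score β₀ z δ = ∑ k, D.scoreVec β₀ z k * δ k := by
  simp only [score_eq_sum, scoreVec, Matrix.mulVec, dotProduct, Finset.mul_sum, Finset.sum_mul]
  rw [Finset.sum_comm]
  exact Finset.sum_congr rfl fun k _ => Finset.sum_congr rfl fun a _ => by ring

theorem sum_mul_le_sum_groupNorm (v δ : D.Coef) :
    ∑ k, v k * δ k ≤ ∑ j, D.groupNorm v j * D.groupNorm δ j := by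
  rw [← Finset.sum_fiberwise Finset.univ D.grp]
  refine Finset.sum_le_sum fun j _ => ?_
  rw [Finset.sum_subtype (p := fun k => D.grp k = j) _ (by simp) fun k => v k * δ k]
  exact sum_mul_le_l2norm_mul _ _

theorem score_le (β₀ : D.Coef) (z : D.Response) (δ : D.Coef) {c : ℝ}
    (h : ∀ j, D.groupNorm (D.scoreVec β₀ z) j ≤ c) : D.score β₀ z δ ≤ c * D.norm21 δ := by
  rw [score_eq_sum_scoreVec]
  refine (D.sum_mul_le_sum_groupNorm _ _).trans ?_
  rw [norm21, Finset.mul_sum]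
  exact Finset.sum_le_sum fun j _ =>
    mul_le_mul_of_nonneg_right (h j) (D.groupNorm_nonneg δ j)

theorem dotProduct_covY_mulVec (β₀ : D.Coef) (x : Fin n × Fin D.r → ℝ) :
    x ⬝ᵥ (D.covY β₀ *ᵥ x) =
      ∑ z, D.lik β₀ z * (∑ a, (D.indic z a - D.meanY β₀ a) * x a) ^ 2 := by
  simp only [covY, Matrix.mulVec, dotProduct, Matrix.of_apply, Finset.mul_sum, Finset.sum_mul, sq]
  rw [Finset.sum_congr rfl fun a _ => Finset.sum_comm, Finset.sum_comm]
  exact Finset.sum_congr rfl fun z _ => Finset.sum_congr rfl fun a _ =>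
    Finset.sum_congr rfl fun b _ => by ring

theorem posSemidef_covY (β₀ : D.Coef) : (D.covY β₀).PosSemidef := by
  refine Matrix.PosSemidef.of_dotProduct_mulVec_nonneg ?_ fun x => ?_
  · ext a b
    simp only [covY, Matrix.conjTranspose_apply, Matrix.of_apply, star_trivial]
    exact Finset.sum_congr rfl fun z _ => by ring
  · rw [star_trivial, dotProduct_covY_mulVec]
    exact Finset.sum_nonneg fun z _ => mul_nonneg (D.lik_pos β₀ z).le (sq_nonneg _)

theorem l2norm_sqrt_mulVec_sq {ι : Type*} [Fintype ι] [DecidableEq ι] {W : Matrix ι ι ℝ}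
    (hW : W.PosSemidef) (x : ι → ℝ) : l2norm (CFC.sqrt W *ᵥ x) ^ 2 = x ⬝ᵥ (W *ᵥ x) := by
  have h0 : 0 ≤ W := hW.nonneg
  have hH : (CFC.sqrt W)ᴴ = CFC.sqrt W :=
    (Matrix.nonneg_iff_posSemidef.1 (CFC.sqrt_nonneg W)).isHermitian
  rw [Matrix.conjTranspose_eq_transpose_of_trivial] at hH
  conv_rhs => rw [← CFC.sqrt_mul_sqrt_self W h0]
  rw [← Matrix.mulVec_mulVec, Matrix.dotProduct_mulVec, ← Matrix.mulVec_transpose, hH, l2norm_sq]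
  simp [dotProduct, sq]

/-- The quadratic form of `W` at `Xδ` is the variance of the score, and the individuals are
independent. -/
theorem l2norm_sqrt_covY_sq (β₀ δ : D.Coef) :
    l2norm (CFC.sqrt (D.covY β₀) *ᵥ (D.fullX *ᵥ δ)) ^ 2 = ∑ i, D.catVar β₀ δ i := by
  rw [l2norm_sqrt_mulVec_sq (D.posSemidef_covY β₀), dotProduct_covY_mulVec]
  simp only [← score_eq_sum]
  exact sum_pi_prod_mul_sum_sq (fun i c => D.catProb β₀ i c) (D.sum_catProb β₀)
    (fun i c => D.catLin δ i c - D.catMean β₀ δ i) (D.sum_catProb_mul_sub_catMean β₀ δ)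

/-! ### The compatibility number -/

theorem compat_nonneg (β₀ : D.Coef) (S : Finset (Fin D.p)) : 0 ≤ D.compat β₀ S := by
  refine Real.sInf_nonneg ?_
  rintro t ⟨β, -, -, rfl⟩
  exact div_nonneg (mul_nonneg (l2norm_nonneg _) (Real.sqrt_nonneg _))
    (mul_nonneg (D.starNorm_nonneg _) (D.norm21_nonneg β))

theorem compat_le {β₀ : D.Coef} {S : Finset (Fin D.p)} {β : D.Coef}
    (h : D.norm21On Sᶜ β ≤ 7 * D.norm21On S β) (hne : ∃ k, D.grp k ∈ S ∧ β k ≠ 0) :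
    D.compat β₀ S ≤ l2norm (CFC.sqrt (D.covY β₀) *ᵥ (D.fullX *ᵥ β)) * Real.sqrt S.card /
      (D.starNorm D.fullX * D.norm21 β) := by
  refine csInf_le ⟨0, ?_⟩ ⟨β, h, hne, rfl⟩
  rintro t ⟨β, -, -, rfl⟩
  exact div_nonneg (mul_nonneg (l2norm_nonneg _) (Real.sqrt_nonneg _))
    (mul_nonneg (D.starNorm_nonneg _) (D.norm21_nonneg β))

theorem groupNorm_pos {β : D.Coef} {k : Fin D.d} (h : β k ≠ 0) :
    0 < D.groupNorm β (D.grp k) :=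
  (D.groupNorm_nonneg β _).lt_of_ne' fun h0 => h (D.groupNorm_eq_zero.1 h0 k rfl)

theorem norm21_pos {β : D.Coef} {k : Fin D.d} (h : β k ≠ 0) : 0 < D.norm21 β :=
  (D.groupNorm_pos h).trans_le (Finset.single_le_sum (f := fun j => D.groupNorm β j)
    (fun j _ => D.groupNorm_nonneg β j) (Finset.mem_univ _))

/-- The lower bound for the variance of the linear predictor on the cone. -/
theorem compat_sq_mul_le (hX : D.X ≠ 0) {β₀ : D.Coef} {S : Finset (Fin D.p)} {δ : D.Coef}
    (h : D.norm21On Sᶜ δ ≤ 7 * D.norm21On S δ) (hne : ∃ k, D.grp k ∈ S ∧ δ k ≠ 0) :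
    D.compat β₀ S ^ 2 * (D.starNorm D.fullX * D.norm21 δ) ^ 2 ≤
      (∑ i, D.catVar β₀ δ i) * S.card := by
  obtain ⟨k, _, hk⟩ := hne
  have hA := D.starNorm_pos (D.fullX_ne_zero hX)
  have hx := D.norm21_pos hk
  have h1 := D.compat_le (β₀ := β₀) h ⟨k, ‹_›, hk⟩
  rw [le_div_iff₀ (by positivity)] at h1
  have h2 := pow_le_pow_left₀
    (mul_nonneg (D.compat_nonneg β₀ S) (by positivity)) h1 2
  rwa [mul_pow, mul_pow (l2norm _), l2norm_sqrt_covY_sq, Real.sq_sqrt (Nat.cast_nonneg _)] at h2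

/-- The test vector has one coordinate `±1` in each group of `S`, so its `‖·‖_{2,1}` is `|S|`.
Suitable signs make the images no longer than orthogonal ones would be, hence at most `√|S| ·
‖X‖_*`. A single coordinate would only give `√|S|`. -/
theorem compat_le_one (hX : D.X ≠ 0) (β₀ : D.Coef) {S : Finset (Fin D.p)} (hS : S.Nonempty) :
    D.compat β₀ S ≤ 1 := by
  classical
  have hA := D.starNorm_pos (D.fullX_ne_zero hX)
  choose κ hκ using D.grp_surjective
  let b : Fin D.p → D.Coef := fun j => Pi.single (κ j) 1
  let V : D.Coef → EuclideanSpace ℝ (Fin n × Fin D.r) := fun β =>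
    WithLp.toLp 2 (CFC.sqrt (D.covY β₀) *ᵥ (D.fullX *ᵥ β))
  obtain ⟨ε, hε, hsq⟩ := exists_signs_norm_sum_sq_le S fun j => V (b j)
  have hε0 (j : Fin D.p) : ε j ≠ 0 := fun h => by simpa [h] using hε j
  let δ : D.Coef := ∑ j ∈ S, ε j • b j
  have hV : V δ = ∑ j ∈ S, ε j • V (b j) := by
    simp only [V, δ, Matrix.mulVec_sum, Matrix.mulVec_smul, WithLp.toLp_sum, WithLp.toLp_smul]
  have hbne (i j : Fin D.p) (hij : i ≠ j) : D.groupNorm (b j) i = 0 := by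
    rw [groupNorm_eq_zero]
    intro k hk
    refine Pi.single_eq_of_ne (fun h => hij ?_) _
    rw [← hk, h, hκ]
  have hb (j : Fin D.p) : D.groupNorm (b j) j = 1 := by
    rw [← sq_eq_sq₀ (D.groupNorm_nonneg _ _) zero_le_one, groupNorm_sq,
      Fintype.sum_eq_single (⟨κ j, hκ j⟩ : {k // D.grp k = j})]
    · simp [b]
    · rintro ⟨k, hk⟩ hne
      simp only [b]
      rw [Pi.single_eq_of_ne (fun h => hne (Subtype.ext h))]
      simp
  have hpart (j : Fin D.p) : ∀ k, D.grp k = j → δ k = ((if j ∈ S then ε j else 0) • b j) k := by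
    intro k hk
    simp only [δ, Finset.sum_apply, Pi.smul_apply, smul_eq_mul]
    by_cases hj : j ∈ S
    · rw [Finset.sum_eq_single_of_mem j hj, if_pos hj]
      intro i _ hij
      rw [D.groupNorm_eq_zero.1 (hbne j i hij.symm) k hk, mul_zero]
    · rw [if_neg hj, zero_mul]
      refine Finset.sum_eq_zero fun i hi => ?_
      rw [D.groupNorm_eq_zero.1 (hbne j i (fun h => hj (h ▸ hi))) k hk, mul_zero]
  have hδ (j : Fin D.p) : D.groupNorm δ j = if j ∈ S then 1 else 0 := by
    rw [D.groupNorm_congr (hpart j), groupNorm_smul, hb, mul_one]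
    split_ifs
    · exact hε j
    · simp
  have hN : D.norm21 δ = S.card := by simp [norm21, hδ]
  have hNS : D.norm21On Sᶜ δ = 0 :=
    Finset.sum_eq_zero fun j hj => by simp [hδ, Finset.mem_compl.1 hj]
  obtain ⟨j, hj⟩ := hS
  have hS0 : (0 : ℝ) < S.card := by exact_mod_cast Finset.card_pos.2 ⟨j, hj⟩
  have h1 := D.compat_le (β₀ := β₀) (S := S) (β := δ)
    (by rw [hNS]; exact mul_nonneg (by norm_num) (D.norm21On_nonneg _ _))
    ⟨κ j, by rwa [hκ], by rw [hpart j _ (hκ j)]; simp [hj, b, hε0 j]⟩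
  refine h1.trans ?_
  rw [hN, div_le_one (by positivity)]
  have hVb (j : Fin D.p) : ‖V (b j)‖ ^ 2 ≤ D.starNorm D.fullX ^ 2 := by
    have h2 : ‖V (b j)‖ ^ 2 = ∑ i, D.catVar β₀ (b j) i := D.l2norm_sqrt_covY_sq β₀ (b j)
    rw [h2]
    refine (Finset.sum_le_sum fun i _ => D.catVar_le β₀ (b j) i).trans ?_
    rw [← l2norm_fullX_mulVec_sq]
    refine pow_le_pow_left₀ (l2norm_nonneg _) ((D.l2norm_mulVec_le_norm21 _ _).trans ?_) 2
    rw [norm21, Finset.sum_eq_single j (fun i _ hi => hbne i j hi) (by simp), hb, mul_one]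
  have hV2 : l2norm (CFC.sqrt (D.covY β₀) *ᵥ (D.fullX *ᵥ δ)) ≤
      Real.sqrt S.card * D.starNorm D.fullX := by
    refine (abs_le_of_sq_le_sq' ?_ (by positivity)).2
    rw [mul_pow, Real.sq_sqrt hS0.le]
    calc _ = ‖V δ‖ ^ 2 := rfl
      _ ≤ ∑ j ∈ S, ‖V (b j)‖ ^ 2 := by rw [hV]; exact hsq
      _ ≤ ∑ _j ∈ S, D.starNorm D.fullX ^ 2 := Finset.sum_le_sum fun j _ => hVb j
      _ = _ := by rw [Finset.sum_const, nsmul_eq_mul]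
  calc _ ≤ Real.sqrt S.card * D.starNorm D.fullX * Real.sqrt S.card :=
        mul_le_mul_of_nonneg_right hV2 (Real.sqrt_nonneg _)
    _ = D.starNorm D.fullX * S.card := by
        rw [mul_right_comm, Real.mul_self_sqrt hS0.le, mul_comm]

theorem maxStarNorm_pos (hX : D.X ≠ 0) : 0 < D.maxStarNorm :=
  D.maxStarNorm_nonneg.lt_of_ne' fun h => by
    have := D.starNorm_fullX_le
    rw [h, mul_zero] at this
    exact absurd (D.starNorm_pos (D.fullX_ne_zero hX)) this.not_gt

/-- If the compatibility number vanished, so would the right side of the condition defining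
`trueSet`, while its left side is positive. -/
theorem compat_pos_of_mem_trueSet (hX : D.X ≠ 0) (hL : 0 < D.logFactor) {M : ℝ}
    {β₀ : D.Coef} (hβ : β₀ ∈ D.trueSet M) (hs : 0 < D.activeCount β₀) :
    0 < D.compat β₀ (D.activeGroups β₀) := by
  refine (D.compat_nonneg _ _).lt_of_ne' fun h => ?_
  have h1 : (D.activeCount β₀ : ℝ) * Real.sqrt D.logFactor * D.maxStarNorm ≤
    M * D.compat β₀ (D.activeGroups β₀) ^ 2 * D.starNorm D.fullX := hβ
  have hξ := D.maxStarNorm_pos hX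
  have hs' : (0 : ℝ) < D.activeCount β₀ := by exact_mod_cast hs
  have : 0 < (D.activeCount β₀ : ℝ) * Real.sqrt D.logFactor * D.maxStarNorm := by positivity
  rw [h] at h1
  simp at h1
  linarith

/-- Bound `φ²` by `1` and `‖X‖_*` by `√n` times the maximal block norm in the condition on `β₀`,
then cancel that norm. This controls the factorial of the ball volume. -/
theorem activeCount_mul_sqrt_le (hX : D.X ≠ 0) {M : ℝ} (hM : M ≤ 1)
    {β₀ : D.Coef} (hβ : β₀ ∈ D.trueSet M) :
    (D.activeCount β₀ : ℝ) * Real.sqrt D.logFactor ≤ Real.sqrt n := by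
  rcases Nat.eq_zero_or_pos (D.activeCount β₀) with hs | hs
  · simp [hs]
  have h1 : (D.activeCount β₀ : ℝ) * Real.sqrt D.logFactor * D.maxStarNorm ≤
    M * D.compat β₀ (D.activeGroups β₀) ^ 2 * D.starNorm D.fullX := hβ
  have hξ := D.maxStarNorm_pos hX
  have hc := D.compat_le_one hX β₀ (Finset.card_pos.1 hs)
  have hc2 : D.compat β₀ (D.activeGroups β₀) ^ 2 ≤ 1 := pow_le_one₀ (D.compat_nonneg _ _) hc
  have hA := D.starNorm_nonneg D.fullX
  refine le_of_mul_le_mul_right (h1.trans ?_) hξ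
  refine le_trans ?_ D.starNorm_fullX_le
  exact mul_le_of_le_one_left hA (mul_le_one₀ hM (sq_nonneg _) hc2)

/-! ### The exponent of the posterior density -/

/-- Here `φ` stands for the squared compatibility number, `q` for `√L`, `x` for `‖δ‖_{2,1}`, `V` for
the total variance and `K` for the sum of the cumulants. In the rescaled variable `y` the claim is a
scalar inequality times `s q²/φ`. -/
theorem quadratic_tradeoff {A q s x ξ φ V K : ℝ} (hA : 0 < A) (hq : 0 < q) (hs : 0 < s)
    (hx : 0 ≤ x) (hξ0 : 0 ≤ ξ) (hφ : 0 < φ) (hV : φ * (A * x) ^ 2 ≤ V * s)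
    (hξ : s * q * ξ ≤ 1 / 8000 * φ * A) (hK : (1 + 8 * ξ * x)⁻¹ * (0.4 * V) ≤ K) :
    12 * A * q * x - K ≤ 95 * (s * q ^ 2 / φ) := by
  set y := φ * A * x / (s * q) with hy
  have hy0 : 0 ≤ y := by positivity
  -- This is where the value `M₁ = 1/8000` enters.
  have h8 : 8 * ξ * x ≤ y / 1000 := by
    rw [hy, div_div, le_div_iff₀ (by positivity)]
    nlinarith [mul_le_mul_of_nonneg_right hξ hx]
  have hVy : s * q ^ 2 / φ * y ^ 2 ≤ V := by
    have : s * q ^ 2 / φ * y ^ 2 = φ * (A * x) ^ 2 / s := by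
      rw [hy]; field_simp
    rw [this, div_le_iff₀ hs]
    exact hV
  have hxy : 12 * A * q * x = s * q ^ 2 / φ * (12 * y) := by
    rw [hy]; field_simp
  have hQ : 0 < s * q ^ 2 / φ := by positivity
  set Q := s * q ^ 2 / φ
  have hK2 : (1 + y / 1000)⁻¹ * (0.4 * (Q * y ^ 2)) ≤ K := by
    refine le_trans ?_ hK
    refine mul_le_mul ?_ (by linarith) (by positivity) (by positivity)
    exact inv_anti₀ (by positivity) (by linarith)
  -- Without the damping factor the maximum of `12y - 0.4y²` is `90`, at `y = 15`; the margin up to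
  -- `95` absorbs the factor.
  have hmain : 12 * y ≤ 95 + (1 + y / 1000)⁻¹ * (0.4 * y ^ 2) := by
    rw [inv_mul_eq_div, ← sub_le_iff_le_add', le_div_iff₀ (by positivity)]
    nlinarith [sq_nonneg (y - 15)]
  rw [hxy]
  have := mul_le_mul_of_nonneg_left hmain hQ.le
  have h3 : Q * (95 + (1 + y / 1000)⁻¹ * (0.4 * y ^ 2)) =
    95 * Q + (1 + y / 1000)⁻¹ * (0.4 * (Q * y ^ 2)) := by ring
  linarith

/-- Triangle inequality on the active groups; on the others `β₀` vanishes and `δ` counts in full. -/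
theorem norm21_sub_norm21_add_le (β₀ δ : D.Coef) :
    D.norm21 β₀ - D.norm21 (β₀ + δ) ≤
      D.norm21On (D.activeGroups β₀) δ - D.norm21On (D.activeGroups β₀)ᶜ δ := by
  set S := D.activeGroups β₀
  rw [← D.norm21On_add_compl S β₀, ← D.norm21On_add_compl S (β₀ + δ)]
  have h0 (j : Fin D.p) (hj : j ∈ Sᶜ) : D.groupNorm β₀ j = 0 :=
    D.groupNorm_eq_zero_of_notMem (Finset.mem_compl.1 hj)
  have h1 : D.norm21On Sᶜ β₀ = 0 := Finset.sum_eq_zero h0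
  have h2 : D.norm21On Sᶜ (β₀ + δ) = D.norm21On Sᶜ δ :=
    Finset.sum_congr rfl fun j hj => D.groupNorm_congr fun k hk => by
      rw [Pi.add_apply, D.groupNorm_eq_zero.1 (h0 j hj) k hk, zero_add]
  have h3 := D.norm21On_add_le S (β₀ + δ) (-δ)
  rw [add_neg_cancel_right, norm21On_neg] at h3
  linarith

/-- The left side collects the log ratio of the slab densities, the worst score on `ScoreSmall` and
the cumulants. A term `-(λ/4)‖δ‖` is kept on the right to make the bound integrable over every
model. -/
theorem exponent_le (hX : D.X ≠ 0) (hL : 0 < D.logFactor) {β₀ : D.Coef}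
    (hβ : β₀ ∈ D.trueSet (1 / 8000)) (δ : D.Coef) :
    D.slabRate * (D.norm21 β₀ - D.norm21 (β₀ + δ)) + D.slabRate / 4 * D.norm21 δ -
        ∑ i, D.cumul β₀ δ i ≤
      -(D.slabRate / 4) * D.norm21 δ +
        95 * (D.activeCount β₀ * D.logFactor / D.compat β₀ (D.activeGroups β₀) ^ 2) := by
  have hA := D.starNorm_pos (D.fullX_ne_zero hX)
  have hq : 0 < Real.sqrt D.logFactor := Real.sqrt_pos.2 hL
  have hlam : 0 < D.slabRate := by unfold slabRate; positivity
  have hξ := D.maxStarNorm_nonneg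
  have hx := D.norm21_nonneg δ
  have hR : 0 ≤ 95 * (D.activeCount β₀ * D.logFactor /
    D.compat β₀ (D.activeGroups β₀) ^ 2) := by positivity
  have hsplit := D.norm21On_add_compl (D.activeGroups β₀) δ
  have hN1 := D.norm21On_nonneg (D.activeGroups β₀) δ
  have hN2 := D.norm21On_nonneg (D.activeGroups β₀)ᶜ δ
  have hdiff := mul_le_mul_of_nonneg_left (D.norm21_sub_norm21_add_le β₀ δ) hlam.le
  have hV0 : 0 ≤ ∑ i, D.catVar β₀ δ i := by
    rw [← l2norm_sqrt_covY_sq]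
    positivity
  have hK : (1 + 8 * D.maxStarNorm * D.norm21 δ)⁻¹ * (0.4 * ∑ i, D.catVar β₀ δ i) ≤
      ∑ i, D.cumul β₀ δ i := by
    have hpos : 0 < 1 + 8 * D.maxStarNorm * D.norm21 δ := by positivity
    refine D.le_sum_cumul β₀ δ (inv_pos.2 hpos) (inv_le_one_of_one_le₀ ?_) ?_
    · have : 0 ≤ 8 * D.maxStarNorm * D.norm21 δ := by positivity
      linarith
    · rw [inv_mul_le_iff₀ hpos]
      nlinarith
  have hK0 : 0 ≤ ∑ i, D.cumul β₀ δ i := le_trans (by positivity) hK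
  by_cases hcone : D.norm21On (D.activeGroups β₀)ᶜ δ ≤ 7 * D.norm21On (D.activeGroups β₀) δ
  · by_cases hne : ∃ k, D.grp k ∈ D.activeGroups β₀ ∧ δ k ≠ 0
    · have hs : 0 < D.activeCount β₀ := by
        obtain ⟨k, hk, -⟩ := hne
        exact Finset.card_pos.2 ⟨_, hk⟩
      have hφ := D.compat_pos_of_mem_trueSet hX hL hβ hs
      have h := quadratic_tradeoff hA hq (s := D.activeCount β₀) (by exact_mod_cast hs) hx hξ
        (pow_pos hφ 2) (D.compat_sq_mul_le hX hcone hne) hβ hK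
      rw [Real.sq_sqrt hL.le] at h
      have h12 : 12 * D.starNorm D.fullX * Real.sqrt D.logFactor * D.norm21 δ =
          3 / 2 * D.slabRate * D.norm21 δ := by
        rw [slabRate]; ring
      rw [h12] at h
      nlinarith [mul_nonneg hlam.le hN2]
    -- In the cone but zero on the active groups: then `δ` has norm `0`. This includes the case `β₀
    -- = 0`.
    · have hz : D.norm21On (D.activeGroups β₀) δ = 0 :=
        Finset.sum_eq_zero fun j hj => D.groupNorm_eq_zero.2 fun k hk => by
          by_contra h0
          exact hne ⟨k, hk ▸ hj, h0⟩
      have hz2 : D.norm21On (D.activeGroups β₀)ᶜ δ = 0 := by linarith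
      have hz3 : D.norm21 δ = 0 := by linarith
      rw [hz, hz2] at hdiff
      rw [hz3]
      linarith
  -- Off the cone, with `N₁`, `N₂` the norms of `δ` on and off the active groups, the linear terms
  -- total at most `λ(3N₁/2 - N₂/2) ≤ 0`.
  · nlinarith

/-! ### Concentration of the score -/

/-- The likelihood at `β₀ + δ` sums to `1`. -/
theorem sum_lik_mul_exp_score (β₀ δ : D.Coef) :
    ∑ z, D.lik β₀ z * Real.exp (D.score β₀ z δ) = Real.exp (∑ i, D.cumul β₀ δ i) := by
  have h := D.sum_lik (β₀ + δ)
  simp only [lik_add, Real.exp_sub, ← mul_div_assoc] at h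
  rw [← Finset.sum_div, div_eq_one_iff_eq (Real.exp_pos _).ne'] at h
  exact h

theorem groupSize_le (j : Fin D.p) : D.groupSize j ≤ D.maxGroupSize :=
  Finset.le_sup (f := D.groupSize) (Finset.mem_univ j)

theorem card_group (j : Fin D.p) :
    Fintype.card {k : Fin D.d // D.grp k = j} = D.groupSize j := Fintype.card_subtype _

/-- Linear functionals of one group of the score vector are scores of directions supported on that
group, and their cumulants are at most `A²‖g‖²/2`. -/
theorem sum_lik_mul_exp_groupNorm_sq_le (hX : D.X ≠ 0) (β₀ : D.Coef) (j : Fin D.p) :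
    ∑ z, D.lik β₀ z *
        Real.exp (3 / 8 * D.groupNorm (D.scoreVec β₀ z) j ^ 2 / D.starNorm D.fullX ^ 2) ≤
      2 ^ D.maxGroupSize := by
  have hA := D.starNorm_pos (D.fullX_ne_zero hX)
  simp only [groupNorm_sq]
  refine (sum_mul_exp_sq_le (D.lik β₀)
    (fun z (k : {k : Fin D.d // D.grp k = j}) => D.scoreVec β₀ z k) hA fun g => ?_).trans ?_
  · let δ : D.Coef := fun k => if h : D.grp k = j then g ⟨k, h⟩ else 0
    have hδ : (fun k : {k : Fin D.d // D.grp k = j} => δ k) = g := by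
      ext k
      simp [δ, k.2]
    have hscore (z : D.Response) :
        ∑ k : {k : Fin D.d // D.grp k = j}, D.scoreVec β₀ z k * g k =
          D.score β₀ z (D.groupPart j δ) := by
      rw [score_eq_sum_scoreVec]
      simp only [groupPart, mul_ite, mul_zero]
      rw [← Finset.sum_filter, ← hδ]
      exact (Finset.sum_subtype _ (by simp) fun k => D.scoreVec β₀ z k * δ k).symm
    simp only [hscore, sum_lik_mul_exp_score]
    refine Real.exp_le_exp.2 ((D.sum_cumul_le β₀ _).trans ?_)
    have h := pow_le_pow_left₀ (l2norm_nonneg _)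
      (D.l2norm_mulVec_groupPart_le D.fullX j δ) 2
    rw [mul_pow, groupNorm, hδ, l2norm_sq g] at h
    linarith
  · rw [card_group]
    exact pow_le_pow_right₀ (by norm_num) (D.groupSize_le j)

/-- The event that the score is small in each group. -/
def ScoreSmall (β₀ : D.Coef) (z : D.Response) : Prop :=
  ∀ j, D.groupNorm (D.scoreVec β₀ z) j ≤ D.slabRate / 4

-- Markov's inequality and a union over the groups. Since `λ/4 = 2A√L`, the exponent at the
-- threshold is `(3/8)·4L = 3L/2`, enough to beat the number of groups, `p ≤ e^L`.
open scoped Classical in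
theorem sum_lik_not_scoreSmall_le (hX : D.X ≠ 0) (hL : 0 ≤ D.logFactor) (β₀ : D.Coef) :
    ∑ z with ¬ D.ScoreSmall β₀ z, D.lik β₀ z ≤
      D.p * 2 ^ D.maxGroupSize * Real.exp (-(3 / 2 * D.logFactor)) := by
  have hA := D.starNorm_pos (D.fullX_ne_zero hX)
  set A := D.starNorm D.fullX with hA_def
  let F : D.Response → Fin D.p → ℝ := fun z j =>
    Real.exp (3 / 8 * D.groupNorm (D.scoreVec β₀ z) j ^ 2 / A ^ 2)
  have hbad (z : D.Response) (hz : ¬ D.ScoreSmall β₀ z) :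
      1 ≤ (∑ j, F z j) * Real.exp (-(3 / 2 * D.logFactor)) := by
    obtain ⟨j, hj⟩ := not_forall.1 hz
    rw [not_le, slabRate, ← hA_def] at hj
    have h1 : F z j ≤ ∑ j, F z j :=
      Finset.single_le_sum (f := F z) (fun j _ => (Real.exp_pos _).le) (Finset.mem_univ j)
    refine le_trans ?_ (mul_le_mul_of_nonneg_right h1 (Real.exp_pos _).le)
    rw [← Real.exp_add, Real.one_le_exp_iff, ← sub_eq_add_neg, sub_nonneg,
      le_div_iff₀ (by positivity)]
    have h2 : (2 * A * Real.sqrt D.logFactor) ^ 2 ≤ D.groupNorm (D.scoreVec β₀ z) j ^ 2 :=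
      pow_le_pow_left₀ (by positivity) (by linarith) 2
    rw [mul_pow, Real.sq_sqrt hL] at h2
    nlinarith
  calc ∑ z with ¬ D.ScoreSmall β₀ z, D.lik β₀ z
      ≤ ∑ z with ¬ D.ScoreSmall β₀ z,
          D.lik β₀ z * ((∑ j, F z j) * Real.exp (-(3 / 2 * D.logFactor))) := by
        refine Finset.sum_le_sum fun z hz => ?_
        exact le_mul_of_one_le_right (D.lik_pos β₀ z).le (hbad z (Finset.mem_filter.1 hz).2)
    _ ≤ ∑ z, D.lik β₀ z * ((∑ j, F z j) * Real.exp (-(3 / 2 * D.logFactor))) := by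
        refine Finset.sum_le_sum_of_subset_of_nonneg (Finset.filter_subset _ _) fun z _ _ => ?_
        exact mul_nonneg (D.lik_pos β₀ z).le (mul_nonneg
          (Finset.sum_nonneg fun j _ => (Real.exp_pos _).le) (Real.exp_pos _).le)
    _ = (∑ j, ∑ z, D.lik β₀ z * F z j) * Real.exp (-(3 / 2 * D.logFactor)) := by
        rw [Finset.sum_comm, Finset.sum_mul]
        refine Finset.sum_congr rfl fun z _ => ?_
        rw [← Finset.mul_sum, mul_assoc]
    _ ≤ (∑ _j : Fin D.p, 2 ^ D.maxGroupSize) * Real.exp (-(3 / 2 * D.logFactor)) :=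
        mul_le_mul_of_nonneg_right (Finset.sum_le_sum fun j _ =>
          D.sum_lik_mul_exp_groupNorm_sq_le hX β₀ j) (Real.exp_pos _).le
    _ = _ := by simp

end LogitDesign

/-! ### Integrals of the exponential of a norm -/

theorem integral_exp_neg_l2norm {κ : Type*} [Fintype κ] [Nonempty κ] :
    ∫ y : κ → ℝ, Real.exp (-l2norm y) =
      Real.sqrt Real.pi ^ Fintype.card κ * Real.Gamma (Fintype.card κ + 1) /
        Real.Gamma (Fintype.card κ / 2 + 1) := by
  have h1 : ∫ y : κ → ℝ, Real.exp (-l2norm y) =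
      ∫ x : EuclideanSpace ℝ κ, Real.exp (-‖x‖ ^ (1 : ℝ)) := by
    rw [← (PiLp.volume_preserving_toLp κ).integral_comp
      (MeasurableEquiv.toLp 2 (κ → ℝ)).measurableEmbedding]
    simp [l2norm]
  have hG : 0 < Real.Gamma (Fintype.card κ + 1) := Real.Gamma_pos_of_pos (by positivity)
  have hG2 : 0 < Real.Gamma (Fintype.card κ / 2 + 1) := Real.Gamma_pos_of_pos (by positivity)
  -- This integral divided by `Γ(dim + 1)` is the volume of the unit ball, which is known for the
  -- Euclidean norm.
  have h2 := MeasureTheory.measure_unitBall_eq_integral_div_gamma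
    (MeasureTheory.volume : MeasureTheory.Measure (EuclideanSpace ℝ κ)) (p := 1) zero_lt_one
  rw [EuclideanSpace.volume_ball, ENNReal.ofReal_one, one_pow, one_mul, finrank_euclideanSpace,
    div_one, ENNReal.ofReal_eq_ofReal_iff (by positivity)
      (div_nonneg (MeasureTheory.integral_nonneg fun _ => (Real.exp_pos _).le) hG.le)] at h2
  rw [h1]
  field_simp at h2 ⊢
  linarith

namespace LogitDesign

variable {n : ℕ} (D : LogitDesign n)

/-- The coefficients of the groups of `S`. -/
abbrev SubCoef (S : Finset (Fin D.p)) : Type := {k : Fin D.d // D.grp k ∈ S} → ℝ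

theorem extend_apply_of_mem {S : Finset (Fin D.p)} (b : D.SubCoef S) {k : Fin D.d}
    (h : D.grp k ∈ S) : D.extend S b k = b ⟨k, h⟩ := dif_pos h

theorem extend_apply_of_notMem {S : Finset (Fin D.p)} (b : D.SubCoef S) {k : Fin D.d}
    (h : D.grp k ∉ S) : D.extend S b k = 0 := dif_neg h

theorem extend_add (S : Finset (Fin D.p)) (b c : D.SubCoef S) :
    D.extend S (b + c) = D.extend S b + D.extend S c := by
  ext k
  by_cases h : D.grp k ∈ S <;> simp [extend, h]

theorem extend_smul (S : Finset (Fin D.p)) (t : ℝ) (b : D.SubCoef S) :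
    D.extend S (t • b) = t • D.extend S b := by
  ext k
  by_cases h : D.grp k ∈ S <;> simp [extend, h]

theorem extend_neg (S : Finset (Fin D.p)) (b : D.SubCoef S) :
    D.extend S (-b) = -D.extend S b := by
  rw [← neg_one_smul ℝ, extend_smul, neg_one_smul]

theorem continuous_extend (S : Finset (Fin D.p)) : Continuous (D.extend S) := by
  refine continuous_pi fun k => ?_
  by_cases h : D.grp k ∈ S
  · simpa only [D.extend_apply_of_mem _ h] using continuous_apply _
  · simpa only [D.extend_apply_of_notMem _ h] using continuous_const

/-- The norm `‖·‖_{2,1}` on the coefficients of the groups of `S`. -/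
def subNorm (S : Finset (Fin D.p)) (b : D.SubCoef S) : ℝ := D.norm21On S (D.extend S b)

theorem subNorm_smul (S : Finset (Fin D.p)) (t : ℝ) (b : D.SubCoef S) :
    D.subNorm S (t • b) = |t| * D.subNorm S b := by
  rw [subNorm, extend_smul, norm21On_smul, subNorm]

theorem subNorm_neg (S : Finset (Fin D.p)) (b : D.SubCoef S) :
    D.subNorm S (-b) = D.subNorm S b := by
  rw [subNorm, extend_neg, norm21On_neg, subNorm]

theorem subNorm_add_le (S : Finset (Fin D.p)) (b c : D.SubCoef S) :
    D.subNorm S (b + c) ≤ D.subNorm S b + D.subNorm S c := by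
  rw [subNorm, extend_add]
  exact D.norm21On_add_le _ _ _

theorem eq_zero_of_subNorm_eq_zero {S : Finset (Fin D.p)} {b : D.SubCoef S}
    (h : D.subNorm S b = 0) : b = 0 := by
  ext ⟨k, hk⟩
  rw [subNorm, norm21On, Finset.sum_eq_zero_iff_of_nonneg fun j _ => D.groupNorm_nonneg _ j] at h
  rw [← D.extend_apply_of_mem b hk]
  exact D.groupNorm_eq_zero.1 (h _ hk) k rfl

theorem continuous_groupNorm (j : Fin D.p) : Continuous fun β : D.Coef => D.groupNorm β j := by
  unfold groupNorm l2norm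
  exact ((PiLp.continuous_toLp 2 _).comp (by fun_prop)).norm

theorem continuous_subNorm (S : Finset (Fin D.p)) : Continuous (D.subNorm S) := by
  unfold subNorm norm21On
  exact continuous_finsetSum _ fun j _ => (D.continuous_groupNorm j).comp (D.continuous_extend S)

theorem norm21_extend (S : Finset (Fin D.p)) (b : D.SubCoef S) :
    D.norm21 (D.extend S b) = D.subNorm S b := by
  rw [← D.norm21On_add_compl S, subNorm, add_eq_left]
  refine Finset.sum_eq_zero fun j hj => D.groupNorm_eq_zero.2 fun k hk => ?_
  exact D.extend_apply_of_notMem b (by rw [hk]; exact Finset.mem_compl.1 hj)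

/-- Coefficients of the groups of `S` from the family of the subvectors of the groups. -/
def ofGroups (S : Finset (Fin D.p)) (x : (j : S) → {k : Fin D.d // D.grp k = j} → ℝ) :
    D.SubCoef S := fun k => x ⟨D.grp k, k.2⟩ ⟨k, rfl⟩

theorem ofGroups_apply (S : Finset (Fin D.p)) (x : (j : S) → {k : Fin D.d // D.grp k = j} → ℝ)
    (j : S) (k : Fin D.d) (hk : D.grp k = j) (h : D.grp k ∈ S) :
    D.ofGroups S x ⟨k, h⟩ = x j ⟨k, hk⟩ := by
  obtain rfl : j = ⟨D.grp k, h⟩ := Subtype.ext hk.symm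
  rfl

/-- The coefficients of the groups of `S`, sorted by group. -/
def sigmaGroupsEquiv (S : Finset (Fin D.p)) :
    (Σ j : S, {k : Fin D.d // D.grp k = j}) ≃ {k : Fin D.d // D.grp k ∈ S} where
  toFun x := ⟨x.2, by rw [x.2.2]; exact x.1.2⟩
  invFun k := ⟨⟨D.grp k, k.2⟩, ⟨k, rfl⟩⟩
  left_inv := by
    rintro ⟨⟨j, hj⟩, ⟨k, hk⟩⟩
    simp only at hk
    subst hk
    rfl
  right_inv _ := rfl

/-- Lebesgue measure is determined on boxes, which regroup to boxes. It permits Fubini over groups,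
where `exp(-‖·‖_{2,1})` factorises. -/
theorem measurePreserving_ofGroups (S : Finset (Fin D.p)) :
    MeasureTheory.MeasurePreserving (D.ofGroups S) := by
  have hm : Measurable (D.ofGroups S) :=
    measurable_pi_lambda _ fun k => (measurable_pi_apply _).comp (measurable_pi_apply _)
  refine ⟨hm, ?_⟩
  refine (MeasureTheory.Measure.pi_eq fun s hs => ?_).symm
  rw [MeasureTheory.Measure.map_apply hm (MeasurableSet.univ_pi hs)]
  have hpre : D.ofGroups S ⁻¹' Set.univ.pi s =
      Set.univ.pi fun j : S => Set.univ.pi fun k : {k : Fin D.d // D.grp k = j} =>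
        s (D.sigmaGroupsEquiv S ⟨j, k⟩) := by
    ext x
    simp only [Set.mem_preimage, Set.mem_univ_pi]
    constructor
    · intro h j k
      have := h (D.sigmaGroupsEquiv S ⟨j, k⟩)
      rwa [show D.ofGroups S x (D.sigmaGroupsEquiv S ⟨j, k⟩) = x j k from
        D.ofGroups_apply S x j k k.2 _] at this
    · intro h k
      exact h ⟨D.grp k, k.2⟩ ⟨k, rfl⟩
  rw [hpre, MeasureTheory.volume_pi_pi]
  simp_rw [MeasureTheory.volume_pi_pi]
  rw [← Fintype.prod_sigma']
  exact Fintype.prod_equiv (D.sigmaGroupsEquiv S) _ _ fun _ => rfl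

theorem subNorm_ofGroups (S : Finset (Fin D.p))
    (x : (j : S) → {k : Fin D.d // D.grp k = j} → ℝ) :
    D.subNorm S (D.ofGroups S x) = ∑ j : S, l2norm (x j) := by
  rw [subNorm, norm21On, ← Finset.sum_coe_sort]
  refine Finset.sum_congr rfl fun j _ => ?_
  unfold groupNorm
  congr 1
  ext k
  have hk : D.grp k ∈ S := by rw [k.2]; exact j.2
  rw [D.extend_apply_of_mem _ hk]
  exact D.ofGroups_apply S x j k k.2 hk

theorem card_subCoef (S : Finset (Fin D.p)) :
    Fintype.card {k : Fin D.d // D.grp k ∈ S} = D.dimOf S := by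
  rw [← Fintype.card_congr (D.sigmaGroupsEquiv S), Fintype.card_sigma, dimOf,
    ← Finset.sum_coe_sort S]
  exact Finset.sum_congr rfl fun j _ => D.card_group _

/-- The integral of `exp (-‖·‖_{2,1})` over the coefficients of the groups of `S`. -/
def slabConst (S : Finset (Fin D.p)) : ℝ :=
  ∏ j ∈ S, (Real.sqrt Real.pi ^ D.groupSize j * Real.Gamma (D.groupSize j + 1) /
    Real.Gamma (D.groupSize j / 2 + 1))

theorem groupSize_pos (j : Fin D.p) : 0 < D.groupSize j := by
  obtain ⟨k, hk⟩ := D.grp_surjective j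
  exact Finset.card_pos.2 ⟨k, by simp [hk]⟩

theorem slabConst_pos (S : Finset (Fin D.p)) : 0 < D.slabConst S :=
  Finset.prod_pos fun j _ => div_pos
    (mul_pos (by positivity) (Real.Gamma_pos_of_pos (by positivity)))
    (Real.Gamma_pos_of_pos (by positivity))

theorem integral_exp_neg_subNorm (S : Finset (Fin D.p)) :
    ∫ b, Real.exp (-D.subNorm S b) = D.slabConst S := by
  have h := (D.measurePreserving_ofGroups S).map_eq
  rw [← h, MeasureTheory.integral_map (D.measurePreserving_ofGroups S).measurable.aemeasurable
    (by exact (Real.continuous_exp.comp (D.continuous_subNorm S).neg).aestronglyMeasurable)]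
  simp_rw [subNorm_ofGroups, ← Finset.sum_neg_distrib, Real.exp_sum]
  rw [MeasureTheory.integral_fintype_prod_volume_eq_prod
    fun (j : S) (y : {k : Fin D.d // D.grp k = j} → ℝ) => Real.exp (-l2norm y), slabConst,
    ← Finset.prod_coe_sort S]
  refine Finset.prod_congr rfl fun j _ => ?_
  have : Nonempty {k : Fin D.d // D.grp k = j} := by
    obtain ⟨k, hk⟩ := D.grp_surjective j
    exact ⟨⟨k, hk⟩⟩
  rw [integral_exp_neg_l2norm, card_group]

theorem integral_exp_neg_mul_subNorm (S : Finset (Fin D.p)) {c : ℝ} (hc : 0 < c) :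
    ∫ b, Real.exp (-(c * D.subNorm S b)) = (c ^ D.dimOf S)⁻¹ * D.slabConst S := by
  have h := MeasureTheory.Measure.integral_comp_smul
    (MeasureTheory.volume : MeasureTheory.Measure (D.SubCoef S))
    (fun b => Real.exp (-D.subNorm S b)) c
  simp only [subNorm_smul, abs_of_pos hc] at h
  rw [h, integral_exp_neg_subNorm, Module.finrank_fintype_fun_eq_card, card_subCoef, smul_eq_mul,
    abs_of_pos (by positivity)]

theorem lintegral_exp_neg_mul_subNorm (S : Finset (Fin D.p)) {c : ℝ} (hc : 0 < c) :
    ∫⁻ b, ENNReal.ofReal (Real.exp (-(c * D.subNorm S b))) =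
      ENNReal.ofReal ((c ^ D.dimOf S)⁻¹ * D.slabConst S) := by
  have hI := D.slabConst_pos S
  rw [← D.integral_exp_neg_mul_subNorm S hc, MeasureTheory.ofReal_integral_eq_lintegral_ofReal]
  · refine MeasureTheory.Integrable.of_integral_ne_zero ?_
    rw [D.integral_exp_neg_mul_subNorm S hc]
    positivity
  · exact Filter.Eventually.of_forall fun b => (Real.exp_pos _).le

/-- For any norm, the volume of the unit ball is the integral of `exp(-norm)` divided by `dim!`;
here the norm is `‖·‖_{2,1}`. The radius enters by scaling. -/
theorem volume_subNorm_lt (S : Finset (Fin D.p)) {r : ℝ} (hr : 0 < r) :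
    MeasureTheory.volume {b : D.SubCoef S | D.subNorm S b < r} =
      ENNReal.ofReal (r ^ D.dimOf S * (D.slabConst S / (D.dimOf S).factorial)) := by
  have h1 := MeasureTheory.measure_lt_one_eq_integral_div_gamma
    (μ := (MeasureTheory.volume : MeasureTheory.Measure (D.SubCoef S))) (g := D.subNorm S)
    (by simpa using D.subNorm_smul S 0 0) (D.subNorm_neg S) (D.subNorm_add_le S)
    D.eq_zero_of_subNorm_eq_zero (fun {t b} => (D.subNorm_smul S t b).le) zero_lt_one
  simp only [Real.rpow_one, integral_exp_neg_subNorm, Module.finrank_fintype_fun_eq_card,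
    card_subCoef, div_one, Real.Gamma_nat_eq_factorial] at h1
  have h2 : {b : D.SubCoef S | D.subNorm S b < r} =
      (fun b => r⁻¹ • b) ⁻¹' {b : D.SubCoef S | D.subNorm S b < 1} := by
    ext b
    simp only [Set.mem_ofPred_eq, Set.mem_preimage, subNorm_smul, abs_of_pos (inv_pos.2 hr)]
    rw [inv_mul_lt_one₀ hr]
  rw [h2, MeasureTheory.Measure.addHaar_preimage_smul _ (inv_ne_zero hr.ne'), h1,
    Module.finrank_fintype_fun_eq_card, card_subCoef, ← ENNReal.ofReal_mul (abs_nonneg _),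
    inv_pow, inv_inv, abs_of_pos (by positivity)]

/-- Normalised form of the slab: `Γ(g/2)/(2Γ(g)) = Γ(g/2 + 1)/Γ(g + 1)`. The constant then cancels
against integrals and ball volumes. -/
theorem slab_eq (S : Finset (Fin D.p)) (b : D.SubCoef S) :
    D.slab S b = D.slabRate ^ D.dimOf S / D.slabConst S *
      Real.exp (-(D.slabRate * D.subNorm S b)) := by
  have hpi : (Real.sqrt Real.pi) ^ D.dimOf S = ∏ j ∈ S, Real.sqrt Real.pi ^ D.groupSize j := by
    rw [dimOf, Finset.prod_pow_eq_pow_sum]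
  have h2 : (2 : ℝ) ^ S.card = ∏ _j ∈ S, (2 : ℝ) := by rw [Finset.prod_const]
  rw [slab, ← subNorm, neg_mul, div_pow, div_mul_eq_mul_div, mul_div_assoc]
  rw [div_eq_mul_inv (_ ^ _) (D.slabConst S)]
  congr 2
  rw [div_div, hpi, h2, slabConst, ← Finset.prod_mul_distrib, ← Finset.prod_mul_distrib,
    ← Finset.prod_div_distrib, ← Finset.prod_inv_distrib]
  refine Finset.prod_congr rfl fun j _ => ?_
  have hg : (0 : ℝ) < D.groupSize j := by exact_mod_cast D.groupSize_pos j
  have hG := Real.Gamma_pos_of_pos hg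
  have hG2 := Real.Gamma_pos_of_pos (half_pos hg)
  rw [Real.Gamma_add_one hg.ne', Real.Gamma_add_one (half_pos hg).ne']
  field_simp

/-! ### Integrals with respect to the prior -/

theorem continuous_catLin (i : Fin n) (c : Fin (D.r + 1)) :
    Continuous fun β : D.Coef => D.catLin β i c := by
  refine Fin.cases ?_ (fun l => ?_) c
  · simpa only [catLin_zero_right] using continuous_const
  · simp only [catLin_succ, Matrix.mulVec, dotProduct]
    fun_prop

theorem continuous_lik (z : D.Response) : Continuous fun β => D.lik β z := by
  unfold lik
  refine continuous_finsetProd _ fun i _ => ?_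
  simp only [catProb_eq]
  refine Continuous.div (Real.continuous_exp.comp (D.continuous_catLin i _))
    (continuous_finsetSum _ fun c _ => Real.continuous_exp.comp (D.continuous_catLin i c))
    fun β => (sum_exp_pos _).ne'

theorem continuous_score (β₀ : D.Coef) (z : D.Response) :
    Continuous fun δ => D.score β₀ z δ := by
  simp only [score_eq_sum_scoreVec]
  fun_prop

theorem continuous_slab (S : Finset (Fin D.p)) : Continuous (D.slab S) := by
  have h : D.slab S = fun b => D.slabRate ^ D.dimOf S / D.slabConst S *
      Real.exp (-(D.slabRate * D.subNorm S b)) := funext (D.slab_eq S)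
  rw [h]
  have := D.continuous_subNorm S
  fun_prop

theorem lintegral_prior (w : ℕ → ℝ) {F : D.Coef → ℝ≥0∞} (hF : Measurable F) :
    ∫⁻ β, F β ∂(D.prior w) = ∑ S : Finset (Fin D.p),
      ENNReal.ofReal (w S.card / (D.p.choose S.card : ℝ)) *
        ∫⁻ b, ENNReal.ofReal (D.slab S b) * F (D.extend S b) := by
  rw [prior, MeasureTheory.lintegral_finsetSum_measure]
  refine Finset.sum_congr rfl fun S _ => ?_
  rw [MeasureTheory.lintegral_smul_measure, MeasureTheory.lintegral_map hF
    (D.continuous_extend S).measurable, MeasureTheory.lintegral_withDensity_eq_lintegral_mul _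
    (D.continuous_slab S).measurable.ennreal_ofReal
    (by exact hF.comp (D.continuous_extend S).measurable)]
  rfl

theorem activeGroups_extend_subset (S : Finset (Fin D.p)) (b : D.SubCoef S) :
    D.activeGroups (D.extend S b) ⊆ S := by
  intro j hj
  obtain ⟨k, hk, hne⟩ := (Finset.mem_filter.1 hj).2
  by_contra h
  exact hne (D.extend_apply_of_notMem b (by rwa [hk]))

theorem measurable_activeCount : Measurable fun β : D.Coef => (D.activeCount β : ℝ) := by
  have h : (fun β : D.Coef => (D.activeCount β : ℝ)) =
      fun β => ∑ j,
        Set.indicator {β : D.Coef | ∃ k, D.grp k = j ∧ β k ≠ 0} (fun _ => (1 : ℝ)) β := by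
    ext β
    simp only [activeCount, activeGroups, Set.indicator_apply, Set.mem_ofPred_eq]
    rw [Finset.card_filter]
    push_cast
    rfl
  rw [h]
  refine Finset.measurable_fun_sum _ fun j _ => measurable_const.indicator ?_
  have h2 : {β : D.Coef | ∃ k, D.grp k = j ∧ β k ≠ 0} =
      ⋃ k, {β : D.Coef | D.grp k = j ∧ β k ≠ 0} := by
    ext β
    simp
  rw [h2]
  refine MeasurableSet.iUnion fun k => ?_
  by_cases hk : D.grp k = j
  · simp only [hk, true_and]
    exact (measurableSet_eq_fun (measurable_pi_apply k) measurable_const).compl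
  · simp [hk]

/-- A vector drawn from the model `S` has at most `|S|` active groups, so smaller models do not
charge the event; on the larger ones the indicator is dropped. -/
theorem lintegral_prior_activeCount_gt (w : ℕ → ℝ) (T : ℝ) (z : D.Response) :
    ∫⁻ β in {β | (D.activeCount β : ℝ) > T}, ENNReal.ofReal (D.lik β z) ∂(D.prior w) ≤
      ∑ S : Finset (Fin D.p) with T < S.card,
        ENNReal.ofReal (w S.card / (D.p.choose S.card : ℝ)) *
          ∫⁻ b, ENNReal.ofReal (D.slab S b) * ENNReal.ofReal (D.lik (D.extend S b) z) := by
  have hB : MeasurableSet {β : D.Coef | (D.activeCount β : ℝ) > T} :=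
    measurableSet_lt measurable_const D.measurable_activeCount
  rw [← MeasureTheory.lintegral_indicator hB, lintegral_prior _ _
    ((D.continuous_lik z).measurable.ennreal_ofReal.indicator hB), Finset.sum_filter]
  refine Finset.sum_le_sum fun S _ => ?_
  split_ifs with hS
  · gcongr with b
    exact Set.indicator_le_self _ _ _
  · refine le_of_eq (mul_eq_zero_of_right _ ?_)
    rw [← MeasureTheory.lintegral_zero]
    congr 1
    ext b
    rw [Set.indicator_of_notMem, mul_zero]
    intro hb
    have h1 : (D.activeCount (D.extend S b) : ℝ) ≤ S.card := by
      exact_mod_cast Finset.card_le_card (D.activeGroups_extend_subset S b)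
    have h2 : T < D.activeCount (D.extend S b) := hb
    exact hS (h2.trans_le h1)

/-! ### Bounds for the integrals over a model -/

/-- The subvector of the groups of `S`. -/
def restr (S : Finset (Fin D.p)) (β : D.Coef) : D.SubCoef S := fun k => β k

/-- `S` need not contain the active groups of `β₀`; coordinates of `β₀` outside `S` only enlarge the
right side. -/
theorem subNorm_sub_restr_le (S : Finset (Fin D.p)) (b : D.SubCoef S) (β₀ : D.Coef) :
    D.subNorm S (b - D.restr S β₀) ≤ D.norm21 (D.extend S b - β₀) := by
  rw [← D.norm21On_add_compl S]
  refine le_add_of_le_of_nonneg (le_of_eq ?_) (D.norm21On_nonneg _ _)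
  refine Finset.sum_congr rfl fun j hj => D.groupNorm_congr fun k hk => ?_
  have hk' : D.grp k ∈ S := by rwa [hk]
  rw [D.extend_apply_of_mem _ hk', Pi.sub_apply, Pi.sub_apply, D.extend_apply_of_mem _ hk', restr]

theorem slabRate_pos (hX : D.X ≠ 0) (hL : 0 < D.logFactor) : 0 < D.slabRate := by
  have := D.starNorm_pos (D.fullX_ne_zero hX)
  have := Real.sqrt_pos.2 hL
  unfold slabRate
  positivity

/-- After `exponent_le` the integrand decays at rate `λ/4` about the restriction of `β₀`, against a
slab normalised for rate `λ`; the quotient of the two normalisations is `4^{d_S}`. -/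
theorem lintegral_slab_mul_lik_le (hX : D.X ≠ 0) (hL : 0 < D.logFactor) {β₀ : D.Coef}
    (hβ : β₀ ∈ D.trueSet (1 / 8000)) {z : D.Response} (hz : D.ScoreSmall β₀ z)
    (S : Finset (Fin D.p)) :
    ∫⁻ b, ENNReal.ofReal (D.slab S b) * ENNReal.ofReal (D.lik (D.extend S b) z) ≤
      ENNReal.ofReal (D.lik β₀ z * Real.exp (-(D.slabRate * D.norm21 β₀)) *
        (Real.exp (95 * (D.activeCount β₀ * D.logFactor /
          D.compat β₀ (D.activeGroups β₀) ^ 2)) * 4 ^ D.dimOf S)) := by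
  have hlam := D.slabRate_pos hX hL
  have hI := D.slabConst_pos S
  set Q := 95 * (D.activeCount β₀ * D.logFactor / D.compat β₀ (D.activeGroups β₀) ^ 2)
  set K := D.lik β₀ z * Real.exp (-(D.slabRate * D.norm21 β₀)) * Real.exp Q *
    (D.slabRate ^ D.dimOf S / D.slabConst S) with hKdef
  have hlik := D.lik_pos β₀ z
  have hK : 0 ≤ K := by positivity
  have hpt (b : D.SubCoef S) :
      ENNReal.ofReal (D.slab S b) * ENNReal.ofReal (D.lik (D.extend S b) z) ≤
        ENNReal.ofReal K * ENNReal.ofReal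
          (Real.exp (-(D.slabRate / 4 * D.subNorm S (b - D.restr S β₀)))) := by
    rw [← ENNReal.ofReal_mul hK, ← ENNReal.ofReal_mul' (D.lik_pos _ z).le]
    refine ENNReal.ofReal_le_ofReal ?_
    have hexp := D.exponent_le hX hL hβ (D.extend S b - β₀)
    have hscore := D.score_le β₀ z (D.extend S b - β₀) hz
    have hlikadd := D.lik_add β₀ (D.extend S b - β₀) z
    have hN := D.subNorm_sub_restr_le S b β₀
    rw [add_sub_cancel, norm21_extend] at hexp
    rw [add_sub_cancel] at hlikadd
    rw [slab_eq, hlikadd, hKdef]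
    have hcalc : Real.exp (-(D.slabRate * D.subNorm S b)) *
        Real.exp (D.score β₀ z (D.extend S b - β₀) - ∑ i, D.cumul β₀ (D.extend S b - β₀) i) ≤
        Real.exp (-(D.slabRate * D.norm21 β₀)) * Real.exp Q *
          Real.exp (-(D.slabRate / 4 * D.subNorm S (b - D.restr S β₀))) := by
      rw [← Real.exp_add, ← Real.exp_add, ← Real.exp_add]
      refine Real.exp_le_exp.2 ?_
      have := mul_le_mul_of_nonneg_left hN hlam.le
      nlinarith
    have hC : 0 ≤ D.lik β₀ z * (D.slabRate ^ D.dimOf S / D.slabConst S) := by positivity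
    have := mul_le_mul_of_nonneg_left hcalc hC
    calc _ = D.lik β₀ z * (D.slabRate ^ D.dimOf S / D.slabConst S) *
          (Real.exp (-(D.slabRate * D.subNorm S b)) * Real.exp (D.score β₀ z (D.extend S b - β₀) -
            ∑ i, D.cumul β₀ (D.extend S b - β₀) i)) := by ring
      _ ≤ _ := this
      _ = _ := by ring
  refine (MeasureTheory.lintegral_mono hpt).trans (le_of_eq ?_)
  rw [MeasureTheory.lintegral_const_mul' _ _ ENNReal.ofReal_ne_top,
    MeasureTheory.lintegral_sub_right_eq_self
      (fun b => ENNReal.ofReal (Real.exp (-(D.slabRate / 4 * D.subNorm S b)))),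
    D.lintegral_exp_neg_mul_subNorm S (by positivity), ← ENNReal.ofReal_mul hK]
  congr 1
  rw [hKdef, div_pow]
  field_simp

theorem extend_restr {S : Finset (Fin D.p)} {β : D.Coef} (h : D.activeGroups β ⊆ S) :
    D.extend S (D.restr S β) = β := by
  ext k
  by_cases hk : D.grp k ∈ S
  · rw [D.extend_apply_of_mem _ hk, restr]
  · rw [D.extend_apply_of_notMem _ hk]
    exact (D.groupNorm_eq_zero.1
      (D.groupNorm_eq_zero_of_notMem fun h' => hk (h h')) k rfl).symm

/-- The ball is symmetric and the score is odd, so `exp(score)` may be averaged with its reflection,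
and `e^x + e^{-x} ≥ 2`. Hence the lower bound needs no event for the response. -/
theorem volume_le_lintegral_exp_score (β₀ : D.Coef) (z : D.Response) (S : Finset (Fin D.p))
    (r : ℝ) :
    MeasureTheory.volume {b : D.SubCoef S | D.subNorm S b < r} ≤
      ∫⁻ b in {b : D.SubCoef S | D.subNorm S b < r},
        ENNReal.ofReal (Real.exp (D.score β₀ z (D.extend S b))) := by
  set E := {b : D.SubCoef S | D.subNorm S b < r} with hE_def
  have hE : MeasurableSet E := measurableSet_lt (D.continuous_subNorm S).measurable measurable_const
  have hm : Measurable fun b : D.SubCoef S =>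
      ENNReal.ofReal (Real.exp (D.score β₀ z (D.extend S b))) :=
    (Real.continuous_exp.comp ((D.continuous_score β₀ z).comp
      (D.continuous_extend S))).measurable.ennreal_ofReal
  have hneg : ∫⁻ b in E, ENNReal.ofReal (Real.exp (-D.score β₀ z (D.extend S b))) =
      ∫⁻ b in E, ENNReal.ofReal (Real.exp (D.score β₀ z (D.extend S b))) := by
    rw [← MeasureTheory.lintegral_indicator hE, ← MeasureTheory.lintegral_indicator hE,
      ← MeasureTheory.lintegral_neg_eq_self (E.indicator _)]
    congr 1
    ext b
    simp only [Set.indicator_apply, hE_def, Set.mem_ofPred_eq, subNorm_neg, extend_neg, score_neg,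
      neg_neg]
  have htwo : 2 * MeasureTheory.volume E ≤
      2 * ∫⁻ b in E, ENNReal.ofReal (Real.exp (D.score β₀ z (D.extend S b))) := by
    calc 2 * MeasureTheory.volume E = ∫⁻ _b in E, 2 := by
          rw [MeasureTheory.setLIntegral_const]
      _ ≤ ∫⁻ b in E, (ENNReal.ofReal (Real.exp (D.score β₀ z (D.extend S b))) +
            ENNReal.ofReal (Real.exp (-D.score β₀ z (D.extend S b)))) := by
          refine MeasureTheory.lintegral_mono fun b => ?_
          rw [← ENNReal.ofReal_add (Real.exp_pos _).le (Real.exp_pos _).le,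
            show (2 : ℝ≥0∞) = ENNReal.ofReal 2 by simp]
          refine ENNReal.ofReal_le_ofReal ?_
          linarith [Real.add_one_le_exp (D.score β₀ z (D.extend S b)),
            Real.add_one_le_exp (-D.score β₀ z (D.extend S b))]
      _ = _ := by rw [MeasureTheory.lintegral_add_left hm, hneg, two_mul]
  exact (ENNReal.mul_le_mul_iff_right (by simp) (by simp)).1 htwo

theorem le_lintegral_slab_mul_lik (hX : D.X ≠ 0) (hL : 0 < D.logFactor) (β₀ : D.Coef)
    (z : D.Response) :
    ENNReal.ofReal (D.lik β₀ z * Real.exp (-(D.slabRate * D.norm21 β₀)) *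
        (Real.exp (-(1 / 2 + 8 * Real.sqrt D.logFactor)) *
          ((8 * Real.sqrt D.logFactor) ^ D.dimOf (D.activeGroups β₀) /
            (D.dimOf (D.activeGroups β₀)).factorial))) ≤
      ∫⁻ b, ENNReal.ofReal (D.slab (D.activeGroups β₀) b) *
        ENNReal.ofReal (D.lik (D.extend (D.activeGroups β₀) b) z) := by
  set S := D.activeGroups β₀
  have hA := D.starNorm_pos (D.fullX_ne_zero hX)
  have hlam := D.slabRate_pos hX hL
  have hI := D.slabConst_pos S
  have hlik := D.lik_pos β₀ z
  have hq := Real.sqrt_pos.2 hL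
  have hlamA : D.slabRate = 8 * Real.sqrt D.logFactor * D.starNorm D.fullX := by
    rw [slabRate]; ring
  set A := D.starNorm D.fullX with hA_def
  set q := Real.sqrt D.logFactor
  -- On this radius `‖Xb‖ ≤ 1`, so the cumulants cost at most `1/2`, and the slab loses at most `λ/A
  -- = 8q`.
  set E := {b : D.SubCoef S | D.subNorm S b < A⁻¹}
  set K := D.lik β₀ z * Real.exp (-(D.slabRate * D.norm21 β₀)) * Real.exp (-(1 / 2 + 8 * q)) *
    (D.slabRate ^ D.dimOf S / D.slabConst S) with hKdef
  have hK : 0 ≤ K := by positivity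
  have hpt (b : D.SubCoef S) (hb : b ∈ E) :
      ENNReal.ofReal K * ENNReal.ofReal (Real.exp (D.score β₀ z (D.extend S b))) ≤
      ENNReal.ofReal (D.slab S (D.restr S β₀ + b)) *
        ENNReal.ofReal (D.lik (D.extend S (D.restr S β₀ + b)) z) := by
    rw [← ENNReal.ofReal_mul hK, ← ENNReal.ofReal_mul' (D.lik_pos _ z).le]
    refine ENNReal.ofReal_le_ofReal ?_
    rw [extend_add, D.extend_restr subset_rfl, lik_add, slab_eq, hKdef]
    have hb' : A * D.subNorm S b ≤ 1 := by
      rw [← le_div_iff₀' hA, one_div]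
      exact le_of_lt hb
    have hN : D.subNorm S (D.restr S β₀ + b) ≤ D.norm21 β₀ + D.subNorm S b := by
      refine (D.subNorm_add_le S _ _).trans (le_of_eq ?_)
      rw [← norm21_extend, D.extend_restr subset_rfl]
    have hcum := D.sum_cumul_le β₀ (D.extend S b)
    have hXb : l2norm (D.fullX *ᵥ D.extend S b) ≤ 1 := by
      refine (D.l2norm_mulVec_le_norm21 _ _).trans ?_
      rwa [norm21_extend]
    have hXb2 := pow_le_one₀ (l2norm_nonneg _) hXb (n := 2)
    have hlamN : D.slabRate * D.subNorm S (D.restr S β₀ + b) ≤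
        D.slabRate * D.norm21 β₀ + 8 * q := by
      refine (mul_le_mul_of_nonneg_left hN hlam.le).trans ?_
      rw [mul_add, hlamA, mul_assoc (8 * q) A (D.subNorm S b)]
      exact add_le_add_right (mul_le_of_le_one_right (by positivity) hb') _
    have hcalc : Real.exp (-(D.slabRate * D.norm21 β₀)) * Real.exp (-(1 / 2 + 8 * q)) *
        Real.exp (D.score β₀ z (D.extend S b)) ≤
        Real.exp (-(D.slabRate * D.subNorm S (D.restr S β₀ + b))) *
          Real.exp (D.score β₀ z (D.extend S b) - ∑ i, D.cumul β₀ (D.extend S b) i) := by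
      rw [← Real.exp_add, ← Real.exp_add, ← Real.exp_add]
      refine Real.exp_le_exp.2 ?_
      linarith
    have hC : 0 ≤ D.lik β₀ z * (D.slabRate ^ D.dimOf S / D.slabConst S) := by positivity
    have := mul_le_mul_of_nonneg_left hcalc hC
    calc _ = D.lik β₀ z * (D.slabRate ^ D.dimOf S / D.slabConst S) *
          (Real.exp (-(D.slabRate * D.norm21 β₀)) * Real.exp (-(1 / 2 + 8 * q)) *
            Real.exp (D.score β₀ z (D.extend S b))) := by ring
      _ ≤ _ := this
      _ = _ := by ring
  calc _ = ENNReal.ofReal K * MeasureTheory.volume E := by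
        rw [D.volume_subNorm_lt S (inv_pos.2 hA), ← ENNReal.ofReal_mul hK]
        congr 1
        rw [hKdef, hlamA]
        simp only [mul_pow, inv_pow]
        field_simp
    _ ≤ ENNReal.ofReal K *
          ∫⁻ b in E, ENNReal.ofReal (Real.exp (D.score β₀ z (D.extend S b))) := by
        gcongr
        exact D.volume_le_lintegral_exp_score β₀ z S _
    _ = ∫⁻ b in E, ENNReal.ofReal K *
          ENNReal.ofReal (Real.exp (D.score β₀ z (D.extend S b))) :=
        (MeasureTheory.lintegral_const_mul' _ _ ENNReal.ofReal_ne_top).symm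
    _ ≤ ∫⁻ b in E, ENNReal.ofReal (D.slab S (D.restr S β₀ + b)) *
        ENNReal.ofReal (D.lik (D.extend S (D.restr S β₀ + b)) z) :=
        MeasureTheory.setLIntegral_mono' (measurableSet_lt
          (D.continuous_subNorm S).measurable measurable_const) hpt
    _ ≤ ∫⁻ b, ENNReal.ofReal (D.slab S (D.restr S β₀ + b)) *
        ENNReal.ofReal (D.lik (D.extend S (D.restr S β₀ + b)) z) :=
        MeasureTheory.setLIntegral_le_lintegral _ _
    _ = _ := MeasureTheory.lintegral_add_left_eq_self
        (fun b => ENNReal.ofReal (D.slab S b) * ENNReal.ofReal (D.lik (D.extend S b) z)) _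

end LogitDesign

theorem sum_geometric_tail_le {r : ℝ} (hr0 : 0 ≤ r) (hr : r ≤ 1 / 2) (s p : ℕ) :
    ∑ k ∈ Finset.Ico (s + 1) (p + 1), r ^ (k - s) ≤ 2 * r := by
  rw [Finset.sum_Ico_eq_sum_range]
  have h (i : ℕ) : r ^ (s + 1 + i - s) = r * r ^ i := by
    rw [← pow_succ', show s + 1 + i - s = i + 1 by omega]
  simp only [h, ← Finset.mul_sum]
  have h2 := geom_sum_mul_neg r (p + 1 - (s + 1))
  have h3 : 0 ≤ r ^ (p + 1 - (s + 1)) := by positivity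
  have h4 : 0 ≤ ∑ i ∈ Finset.range (p + 1 - (s + 1)), r ^ i :=
    Finset.sum_nonneg fun _ _ => by positivity
  rw [mul_comm 2]
  exact mul_le_mul_of_nonneg_left (by nlinarith) hr0

namespace LogitDesign

variable {n : ℕ} (D : LogitDesign n)

/-! ### The dimension prior -/

theorem p_pos (hX : D.X ≠ 0) : 0 < D.p := by
  by_contra h
  refine hX (funext fun i => Matrix.ext fun l k => ?_)
  have := (D.grp k).isLt
  omega

theorem maxGroupSize_pos (hX : D.X ≠ 0) : 0 < D.maxGroupSize :=
  (D.groupSize_pos ⟨0, D.p_pos hX⟩).trans_le (D.groupSize_le _)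

theorem n_pos (hX : D.X ≠ 0) : 0 < n := by
  by_contra h
  refine hX (funext fun i => ?_)
  have := i.isLt
  omega

theorem max_eq_exp_logFactor (hX : D.X ≠ 0) :
    max (D.p : ℝ) ((n : ℝ) ^ D.maxGroupSize) = Real.exp D.logFactor := by
  have hp : (0 : ℝ) < D.p := by exact_mod_cast D.p_pos hX
  have hn : (0 : ℝ) < n := by exact_mod_cast D.n_pos hX
  rw [logFactor, Real.exp_monotone.map_max, Real.exp_log hp, ← Real.log_pow,
    Real.exp_log (by positivity)]

theorem p_le_exp_logFactor (hX : D.X ≠ 0) : (D.p : ℝ) ≤ Real.exp D.logFactor := by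
  rw [← D.max_eq_exp_logFactor hX]
  exact le_max_left _ _

theorem maxGroupSize_mul_log_le : D.maxGroupSize * Real.log n ≤ D.logFactor := le_max_right _ _

theorem log_le_logFactor (hX : D.X ≠ 0) : Real.log n ≤ D.logFactor := by
  refine le_trans ?_ D.maxGroupSize_mul_log_le
  have h : (1 : ℝ) ≤ D.maxGroupSize := by exact_mod_cast D.maxGroupSize_pos hX
  exact le_mul_of_one_le_left (Real.log_natCast_nonneg n) h

theorem dimOf_le (S : Finset (Fin D.p)) : D.dimOf S ≤ S.card * D.maxGroupSize := by
  rw [dimOf, ← smul_eq_mul]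
  exact Finset.sum_le_card_nsmul _ _ _ fun j _ => D.groupSize_le j

variable {D}

theorem IsSizePrior.pos {A₁ A₂ A₃ A₄ : ℝ} {w : ℕ → ℝ} (h : D.IsSizePrior A₁ A₂ A₃ A₄ w)
    (hX : D.X ≠ 0) (hA₁ : 0 < A₁) {s : ℕ} (hs : s ≤ D.p) : 0 < w s := by
  have hratio (s : ℕ) (h1 : 1 ≤ s) (hs : s ≤ D.p) : 0 < w s / w (s - 1) := by
    refine lt_of_lt_of_le ?_ (h.ratio s h1 hs).1
    rw [D.max_eq_exp_logFactor hX]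
    exact div_pos hA₁ (Real.rpow_pos_of_pos (Real.exp_pos _) _)
  refine (h.nonneg s hs).lt_of_ne' fun h0 => ?_
  -- Since `x / 0 = 0`, positivity of the ratios also excludes zero denominators; `w 0` occurs only
  -- as the denominator of the ratio at `1`.
  rcases Nat.eq_zero_or_pos s with rfl | hpos
  · have := hratio 1 le_rfl (D.p_pos hX)
    simp [h0] at this
  · have := hratio s hpos hs
    simp [h0] at this

theorem IsSizePrior.le {A₁ A₂ A₃ A₄ : ℝ} {w : ℕ → ℝ} (h : D.IsSizePrior A₁ A₂ A₃ A₄ w)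
    (hX : D.X ≠ 0) (hA₁ : 0 < A₁) (hA₂ : 0 < A₂) (s k : ℕ) (hs : s + k ≤ D.p) :
    w (s + k) ≤ w s * (A₂ * Real.exp (-(A₄ * D.logFactor))) ^ k := by
  induction k with
  | zero => simp
  | succ k ih =>
    have h1 := (h.ratio (s + k + 1) (by omega) (by omega)).2
    rw [D.max_eq_exp_logFactor hX, ← Real.exp_mul, Nat.add_sub_cancel,
      div_le_iff₀ (h.pos hX hA₁ (by omega)), div_eq_mul_inv, ← Real.exp_neg] at h1
    rw [← add_assoc, pow_succ, ← mul_assoc]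
    refine h1.trans ?_
    rw [mul_comm, mul_comm A₄]
    exact mul_le_mul_of_nonneg_right (by simpa [mul_comm A₄] using ih (by omega)) (by positivity)

/-! ### The posterior probability of large models -/

/-- The denominator keeps only the true model, and the likelihood and slab factor at `β₀` cancels,
so the bound no longer depends on the response. -/
theorem posterior_activeCount_gt_le (hX : D.X ≠ 0) (hL : 0 < D.logFactor) {β₀ : D.Coef}
    (hβ : β₀ ∈ D.trueSet (1 / 8000)) {z : D.Response} (hz : D.ScoreSmall β₀ z) {w : ℕ → ℝ}
    (hw : ∀ s ≤ D.p, 0 < w s) (T : ℝ) :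
    D.posterior w z {β | (D.activeCount β : ℝ) > T} ≤ ENNReal.ofReal
      ((∑ S : Finset (Fin D.p) with T < S.card, w S.card / (D.p.choose S.card : ℝ) *
        (Real.exp (95 * (D.activeCount β₀ * D.logFactor /
          D.compat β₀ (D.activeGroups β₀) ^ 2)) * 4 ^ D.dimOf S)) /
      (w (D.activeCount β₀) / (D.p.choose (D.activeCount β₀) : ℝ) *
        (Real.exp (-(1 / 2 + 8 * Real.sqrt D.logFactor)) *
          ((8 * Real.sqrt D.logFactor) ^ D.dimOf (D.activeGroups β₀) /
            (D.dimOf (D.activeGroups β₀)).factorial)))) := by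
  have hq := Real.sqrt_pos.2 hL
  have hcard (S : Finset (Fin D.p)) : S.card ≤ D.p := by simpa using Finset.card_le_univ S
  have hpri (S : Finset (Fin D.p)) : 0 < w S.card / (D.p.choose S.card : ℝ) :=
    div_pos (hw _ (hcard S)) (by exact_mod_cast Nat.choose_pos (hcard S))
  have hs0 := hpri (D.activeGroups β₀)
  rw [← activeCount] at hs0
  set c := D.lik β₀ z * Real.exp (-(D.slabRate * D.norm21 β₀)) with hc_def
  have hc : 0 < c := mul_pos (D.lik_pos β₀ z) (Real.exp_pos _)
  set E := Real.exp (95 * (D.activeCount β₀ * D.logFactor /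
    D.compat β₀ (D.activeGroups β₀) ^ 2))
  set den := Real.exp (-(1 / 2 + 8 * Real.sqrt D.logFactor)) *
    ((8 * Real.sqrt D.logFactor) ^ D.dimOf (D.activeGroups β₀) /
      (D.dimOf (D.activeGroups β₀)).factorial)
  have hden : 0 < den := by positivity
  have hE : 0 < E := Real.exp_pos _
  have hnum : ∫⁻ β in {β | (D.activeCount β : ℝ) > T}, ENNReal.ofReal (D.lik β z) ∂(D.prior w) ≤
      ENNReal.ofReal (c * ∑ S : Finset (Fin D.p) with T < S.card,
        w S.card / (D.p.choose S.card : ℝ) * (E * 4 ^ D.dimOf S)) := by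
    refine (D.lintegral_prior_activeCount_gt w T z).trans ?_
    rw [Finset.mul_sum, ENNReal.ofReal_sum_of_nonneg fun S _ =>
      mul_nonneg hc.le (mul_nonneg (hpri S).le (by positivity))]
    refine Finset.sum_le_sum fun S _ => ?_
    rw [mul_left_comm, ENNReal.ofReal_mul (hpri S).le]
    gcongr
    exact D.lintegral_slab_mul_lik_le hX hL hβ hz S
  have hdenom : ENNReal.ofReal
      (c * (w (D.activeCount β₀) / (D.p.choose (D.activeCount β₀) : ℝ) * den)) ≤
      ∫⁻ β, ENNReal.ofReal (D.lik β z) ∂(D.prior w) := by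
    rw [D.lintegral_prior w (D.continuous_lik z).measurable.ennreal_ofReal, mul_left_comm,
      ENNReal.ofReal_mul hs0.le]
    refine le_trans ?_ (Finset.single_le_sum (f := fun S : Finset (Fin D.p) =>
      ENNReal.ofReal (w S.card / (D.p.choose S.card : ℝ)) * ∫⁻ b, ENNReal.ofReal (D.slab S b) *
        ENNReal.ofReal (D.lik (D.extend S b) z)) (fun _ _ => zero_le)
        (Finset.mem_univ (D.activeGroups β₀)))
    exact mul_le_mul_right (D.le_lintegral_slab_mul_lik hX hL β₀ z) _
  refine (ENNReal.div_le_div hnum hdenom).trans (le_of_eq ?_)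
  rw [← ENNReal.ofReal_div_of_pos (by positivity), mul_div_mul_left _ _ hc.ne']

/-- There are as many sets of size `s` as the binomial coefficient in their weight, which therefore
cancels. -/
theorem sum_card_gt_le {w : ℕ → ℝ} (hw : ∀ s ≤ D.p, 0 < w s) (T : ℝ) {E : ℝ} (hE : 0 ≤ E) :
    ∑ S : Finset (Fin D.p) with T < S.card,
        w S.card / (D.p.choose S.card : ℝ) * (E * 4 ^ D.dimOf S) ≤
      ∑ s ∈ (Finset.range (D.p + 1)).filter (fun s : ℕ => T < (s : ℝ)),
        w s * (E * 4 ^ (s * D.maxGroupSize)) := by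
  have hcard (S : Finset (Fin D.p)) : S.card ≤ D.p := by simpa using Finset.card_le_univ S
  calc _ ≤ ∑ S : Finset (Fin D.p) with T < S.card,
        w S.card / (D.p.choose S.card : ℝ) * (E * 4 ^ (S.card * D.maxGroupSize)) := by
        refine Finset.sum_le_sum fun S _ => ?_
        have := (hw _ (hcard S)).le
        gcongr
        · norm_num
        · exact D.dimOf_le S
    _ = _ := by
        have h := Finset.sum_powerset_apply_card (x := (Finset.univ : Finset (Fin D.p)))
          (fun s : ℕ => if T < (s : ℝ) then
          w s / (D.p.choose s : ℝ) * (E * 4 ^ (s * D.maxGroupSize)) else 0)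
        rw [Finset.powerset_univ, Finset.card_univ, Fintype.card_fin] at h
        rw [Finset.sum_filter, h, Finset.sum_filter]
        refine Finset.sum_congr rfl fun s hs => ?_
        have hc : (0 : ℝ) < D.p.choose s := by
          exact_mod_cast Nat.choose_pos (Nat.lt_succ_iff.1 (Finset.mem_range.1 hs))
        split_ifs
        · rw [nsmul_eq_mul]
          field_simp
        · simp

/-- For `d = d_{S₀}` one has `d ≤ s₀ḡ ≤ s₀q²`, so `d/(8q) ≤ s₀q ≤ √n`, and `√n` to the power `d` is
at most `exp(s₀ḡ log n / 2)`. -/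
theorem factorial_div_pow_le (hX : D.X ≠ 0) (hn : 1 ≤ Real.log n) {β₀ : D.Coef}
    (hβ : β₀ ∈ D.trueSet (1 / 8000)) :
    ((D.dimOf (D.activeGroups β₀)).factorial : ℝ) /
        (8 * Real.sqrt D.logFactor) ^ D.dimOf (D.activeGroups β₀) ≤
      Real.exp (D.activeCount β₀ * D.logFactor / 2) := by
  have hn0 : (0 : ℝ) < n := by exact_mod_cast D.n_pos hX
  have hL : 0 < D.logFactor := by linarith [D.log_le_logFactor hX]
  have hq := Real.sqrt_pos.2 hL
  have hgL : (D.maxGroupSize : ℝ) ≤ D.logFactor :=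
    le_trans (le_mul_of_one_le_right (Nat.cast_nonneg _) hn) D.maxGroupSize_mul_log_le
  have hsq := D.activeCount_mul_sqrt_le hX (by norm_num) hβ
  set d := D.dimOf (D.activeGroups β₀)
  set q := Real.sqrt D.logFactor
  have hd : (d : ℝ) ≤ D.activeCount β₀ * D.maxGroupSize := by
    exact_mod_cast D.dimOf_le (D.activeGroups β₀)
  have hs0 : (0 : ℝ) ≤ D.activeCount β₀ := Nat.cast_nonneg _
  have hdq : (d : ℝ) / (8 * q) ≤ Real.sqrt n := by
    rw [div_le_iff₀ (by positivity)]
    have h1 : (d : ℝ) ≤ D.activeCount β₀ * (q * q) := by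
      rw [Real.mul_self_sqrt hL.le]
      exact hd.trans (mul_le_mul_of_nonneg_left hgL hs0)
    nlinarith [mul_le_mul_of_nonneg_right hsq hq.le, Real.sqrt_nonneg (n : ℝ)]
  calc (d.factorial : ℝ) / (8 * q) ^ d ≤ (d : ℝ) ^ d / (8 * q) ^ d := by
        gcongr
        exact_mod_cast Nat.factorial_le_pow d
    _ = (d / (8 * q)) ^ d := (div_pow _ _ _).symm
    _ ≤ Real.sqrt n ^ d := by gcongr
    _ = Real.exp (d * (Real.log n / 2)) := by
        rw [← Real.log_sqrt hn0.le, mul_comm, Real.exp_mul, Real.exp_log (Real.sqrt_pos.2 hn0),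
          Real.rpow_natCast]
    _ ≤ _ := by
        refine Real.exp_le_exp.2 ?_
        have h2 := mul_le_mul_of_nonneg_left D.maxGroupSize_mul_log_le hs0
        nlinarith [mul_le_mul_of_nonneg_right hd (by linarith : (0 : ℝ) ≤ Real.log n)]

/-- Applied with `A₂` for the logarithm of the prior constant, `a = ḡ log 4`, `b = 8√L` and `Φ =
1/φ²`. Of the slack `4εLk` left by `M₂ > 3`, three parts pay for `A₂`, for `k a` and for `1/2 + b`;
the fourth is the conclusion. -/
theorem exp_term_le {A₂ A₄ M₂ ε L s k Φ a b : ℝ} (hM₂ : 3 < M₂) (hA₄ : 0 < A₄) (hε0 : 0 < ε)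
    (hε1 : ε ≤ 1 / 4) (hε : ε ≤ A₄ * (1 - 3 / M₂) / 4) (hL : 0 < L) (hs : 0 ≤ s) (hΦ : 0 ≤ Φ)
    (hk1 : 1 ≤ k) (hk : M₂ / A₄ * (1 + 33 * Φ) * s ≤ k) (ha : a ≤ ε * L)
    (hA₂ : A₂ ≤ ε * L) (hb : 1 / 2 + b ≤ ε * L) :
    k * (A₂ - A₄ * L) + (s + k) * a + 95 * (s * L * Φ) + s * L + s * L / 2 + (1 / 2 + b) ≤
      -(ε * L * k) := by
  have hM0 : 0 < M₂ := by linarith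
  have h4 : 3 / M₂ * A₄ ≤ A₄ - 4 * ε := by
    have : A₄ * (1 - 3 / M₂) / 4 * 4 = A₄ - 3 / M₂ * A₄ := by ring
    linarith
  have h5 : 3 * (1 + 33 * Φ) * s ≤ (A₄ - 4 * ε) * k := by
    calc 3 * (1 + 33 * Φ) * s = 3 / M₂ * A₄ * (M₂ / A₄ * (1 + 33 * Φ) * s) := by field_simp
      _ ≤ 3 / M₂ * A₄ * k := mul_le_mul_of_nonneg_left hk (by positivity)
      _ ≤ _ := mul_le_mul_of_nonneg_right h4 (by linarith)
  have h6 := mul_le_mul_of_nonneg_right h5 hL.le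
  have h7 : k * A₂ ≤ k * (ε * L) := mul_le_mul_of_nonneg_left hA₂ (by linarith)
  have h8 : (s + k) * a ≤ (s + k) * (ε * L) := mul_le_mul_of_nonneg_left ha (by linarith)
  have h9 : ε * L ≤ k * (ε * L) := le_mul_of_one_le_left (by positivity) hk1
  have h10 : 0 ≤ s * L := by positivity
  have h11 : 0 ≤ s * L * Φ := by positivity
  have h12 : ε * (s * L) ≤ 1 / 4 * (s * L) := mul_le_mul_of_nonneg_right hε1 h10
  nlinarith

theorem posterior_largeSet_le (hX : D.X ≠ 0) {A₁ A₂ A₃ A₄ M₂ ε : ℝ} (hA₁ : 0 < A₁)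
    (hA₂ : 0 < A₂) (hA₄ : 0 < A₄) (hM₂ : 3 < M₂) {w : ℕ → ℝ}
    (hw : D.IsSizePrior A₁ A₂ A₃ A₄ w) (hε0 : 0 < ε) (hε1 : ε ≤ 1 / 4)
    (hε : ε ≤ A₄ * (1 - 3 / M₂) / 4) (hn1 : 1 ≤ Real.log n) (hn4 : Real.log 4 ≤ ε * Real.log n)
    (hnA : Real.log A₂ ≤ ε * Real.log n) (hn9 : 81 ≤ ε ^ 2 * Real.log n)
    {β₀ : D.Coef} (hβ : β₀ ∈ D.trueSet (1 / 8000)) {z : D.Response} (hz : D.ScoreSmall β₀ z) :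
    D.posterior w z (D.largeSet A₄ M₂ β₀) ≤
      ENNReal.ofReal (2 * Real.exp (-(ε * D.logFactor))) := by
  have hlogL := D.log_le_logFactor hX
  have hL1 : 1 ≤ D.logFactor := hn1.trans hlogL
  have hL : 0 < D.logFactor := by linarith
  have hwpos (s : ℕ) (hs : s ≤ D.p) : 0 < w s := hw.pos hX hA₁ hs
  refine (posterior_activeCount_gt_le hX hL hβ hz hwpos _).trans (ENNReal.ofReal_le_ofReal ?_)
  set S₀ := D.activeGroups β₀
  set s₀ := D.activeCount β₀
  set L := D.logFactor
  set Φ := (D.compat β₀ S₀ ^ 2)⁻¹ with hΦ_def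
  set T := (s₀ : ℝ) + M₂ / A₄ * (1 + 33 / D.compat β₀ S₀ ^ 2) * s₀ with hT_def
  have hT : T = s₀ + M₂ / A₄ * (1 + 33 * Φ) * s₀ := by
    rw [hT_def, hΦ_def, div_eq_mul_inv 33]
  have hΦ : 0 ≤ Φ := by positivity
  have hR : 0 ≤ M₂ / A₄ * (1 + 33 * Φ) * s₀ := by
    have : 0 < M₂ := by linarith
    positivity
  have hs₀ : s₀ ≤ D.p := (Finset.card_le_univ S₀).trans_eq (Fintype.card_fin _)
  have hq := Real.sqrt_pos.2 hL
  set q := Real.sqrt L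
  have hqq : q * q = L := Real.mul_self_sqrt hL.le
  have hεL : ε * Real.log n ≤ ε * L := mul_le_mul_of_nonneg_left hlogL hε0.le
  -- The condition with `81` gives `εq ≥ 9`, so `εL ≥ 9q`.
  have hb : 1 / 2 + 8 * q ≤ ε * L := by
    have h1 : 1 ≤ q := Real.one_le_sqrt.2 hL1
    have h2 : 9 ≤ ε * q := by
      refine (abs_le_of_sq_le_sq' ?_ (by positivity)).2
      nlinarith [mul_le_mul_of_nonneg_left hlogL (sq_nonneg ε)]
    nlinarith
  -- `L` dominates `ḡ log n`, so factors exponential in the dimension of a model are negligible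
  -- against the prior.
  have ha : D.maxGroupSize * Real.log 4 ≤ ε * L := by
    calc D.maxGroupSize * Real.log 4 ≤ D.maxGroupSize * (ε * Real.log n) := by gcongr
      _ = ε * (D.maxGroupSize * Real.log n) := by ring
      _ ≤ _ := mul_le_mul_of_nonneg_left D.maxGroupSize_mul_log_le hε0.le
  have hchoose : (D.p.choose s₀ : ℝ) ≤ Real.exp (s₀ * L) := by
    calc (D.p.choose s₀ : ℝ) ≤ (D.p : ℝ) ^ s₀ := by exact_mod_cast Nat.choose_le_pow D.p s₀
      _ ≤ Real.exp L ^ s₀ := by gcongr; exact D.p_le_exp_logFactor hX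
      _ = _ := (Real.exp_nat_mul _ _).symm
  have hfac := factorial_div_pow_le hX hn1 hβ
  have hC0 : (0 : ℝ) < D.p.choose s₀ := by exact_mod_cast Nat.choose_pos hs₀
  have hw0 := hwpos s₀ hs₀
  set E := Real.exp (95 * (s₀ * L / D.compat β₀ S₀ ^ 2)) with hE_def
  have hE : 0 < E := Real.exp_pos _
  have hden : (w s₀ * (Real.exp (s₀ * L) * Real.exp (s₀ * L / 2) *
        Real.exp (1 / 2 + 8 * q))⁻¹) ≤
      w s₀ / (D.p.choose s₀ : ℝ) * (Real.exp (-(1 / 2 + 8 * q)) *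
        ((8 * q) ^ D.dimOf S₀ / (D.dimOf S₀).factorial)) := by
    have hF : ((8 * q) ^ D.dimOf S₀ / (D.dimOf S₀).factorial : ℝ) =
        ((D.dimOf S₀).factorial / (8 * q) ^ D.dimOf S₀ : ℝ)⁻¹ := (inv_div _ _).symm
    rw [hF, Real.exp_neg, ← mul_inv, div_eq_mul_inv (w s₀), mul_assoc (w s₀), ← mul_inv]
    refine mul_le_mul_of_nonneg_left (inv_anti₀ (by positivity) ?_) hw0.le
    calc _ = (D.p.choose s₀ : ℝ) * ((D.dimOf S₀).factorial / (8 * q) ^ D.dimOf S₀ : ℝ) *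
          Real.exp (1 / 2 + 8 * q) := by ring
      _ ≤ _ := by gcongr
  have hterm (s : ℕ) (hs : s ≤ D.p) (hTs : T < s) :
      w s * (E * 4 ^ (s * D.maxGroupSize)) ≤ Real.exp (-(ε * L)) ^ (s - s₀) *
        (w s₀ * (Real.exp (s₀ * L) * Real.exp (s₀ * L / 2) * Real.exp (1 / 2 + 8 * q))⁻¹) := by
    have hs₀s : s₀ < s := by
      rw [hT] at hTs
      exact_mod_cast lt_of_le_of_lt (le_add_of_nonneg_right hR) hTs
    obtain ⟨k, rfl⟩ := Nat.exists_eq_add_of_lt hs₀s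
    rw [add_assoc] at hs hTs ⊢
    rw [Nat.add_sub_cancel_left]
    set k' := k + 1
    have hk1 : (1 : ℝ) ≤ k' := by exact_mod_cast Nat.succ_pos k
    have hk : M₂ / A₄ * (1 + 33 * Φ) * s₀ ≤ k' := by
      rw [hT] at hTs
      push_cast at hTs
      linarith
    have hwle := hw.le hX hA₁ hA₂ s₀ k' hs
    have hexp := exp_term_le (k := k') (s := s₀) hM₂ hA₄ hε0 hε1 hε hL (Nat.cast_nonneg _) hΦ hk1 hk
      ha (hnA.trans hεL) hb
    have hpow4 : (4 : ℝ) ^ ((s₀ + k') * D.maxGroupSize) =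
        Real.exp ((s₀ + k') * (D.maxGroupSize * Real.log 4)) := by
      rw [← Real.exp_log (show (0 : ℝ) < 4 by norm_num), ← Real.exp_nat_mul,
        Real.exp_log (show (0 : ℝ) < 4 by norm_num)]
      push_cast
      ring_nf
    have hpowA : (A₂ * Real.exp (-(A₄ * L))) ^ k' =
        Real.exp (k' * (Real.log A₂ - A₄ * L)) := by
      rw [Real.exp_nat_mul, sub_eq_add_neg, Real.exp_add, Real.exp_log hA₂]
    calc w (s₀ + k') * (E * 4 ^ ((s₀ + k') * D.maxGroupSize))
        ≤ w s₀ * (A₂ * Real.exp (-(A₄ * L))) ^ k' * (E * 4 ^ ((s₀ + k') * D.maxGroupSize)) :=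
          mul_le_mul_of_nonneg_right hwle (by positivity)
      _ = w s₀ * Real.exp (k' * (Real.log A₂ - A₄ * L) + 95 * (s₀ * L * Φ) +
            (s₀ + k') * (D.maxGroupSize * Real.log 4)) := by
          rw [hpowA, hpow4, hE_def, Real.exp_add, Real.exp_add, hΦ_def, div_eq_mul_inv]
          ring
      _ ≤ w s₀ * Real.exp (k' * -(ε * L) + -(s₀ * L + s₀ * L / 2 + (1 / 2 + 8 * q))) :=
          mul_le_mul_of_nonneg_left (Real.exp_le_exp.2 (by linarith)) hw0.le
      _ = _ := by
          rw [Real.exp_add, Real.exp_nat_mul, Real.exp_neg (_ + _), Real.exp_add, Real.exp_add]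
          ring
  have hX0 : 0 < w s₀ * (Real.exp (s₀ * L) * Real.exp (s₀ * L / 2) *
      Real.exp (1 / 2 + 8 * q))⁻¹ := by positivity
  rw [div_le_iff₀ (hX0.trans_le hden)]
  refine (sum_card_gt_le hwpos T hE.le).trans ?_
  refine le_trans ?_ (mul_le_mul_of_nonneg_left hden (by positivity))
  have hr : Real.exp (-(ε * L)) ≤ 1 / 2 := by
    calc Real.exp (-(ε * L)) ≤ Real.exp (-Real.log 4) :=
          Real.exp_le_exp.2 (neg_le_neg (hn4.trans hεL))
      _ = 1 / 4 := by rw [Real.exp_neg, Real.exp_log (by norm_num)]; norm_num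
      _ ≤ _ := by norm_num
  calc _ ≤ ∑ s ∈ (Finset.range (D.p + 1)).filter (fun s : ℕ => T < (s : ℝ)),
        Real.exp (-(ε * L)) ^ (s - s₀) *
        (w s₀ * (Real.exp (s₀ * L) * Real.exp (s₀ * L / 2) * Real.exp (1 / 2 + 8 * q))⁻¹) := by
        refine Finset.sum_le_sum fun s hs => ?_
        rw [Finset.mem_filter, Finset.mem_range] at hs
        exact hterm s (by omega) hs.2
    _ ≤ ∑ s ∈ Finset.Ico (s₀ + 1) (D.p + 1), Real.exp (-(ε * L)) ^ (s - s₀) *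
        (w s₀ * (Real.exp (s₀ * L) * Real.exp (s₀ * L / 2) * Real.exp (1 / 2 + 8 * q))⁻¹) := by
        refine Finset.sum_le_sum_of_subset_of_nonneg (fun s hs => ?_) fun s _ _ => by positivity
        rw [Finset.mem_filter, Finset.mem_range, hT] at hs
        have : s₀ < s := by
          exact_mod_cast lt_of_le_of_lt (le_add_of_nonneg_right hR) hs.2
        exact Finset.mem_Ico.2 ⟨this, hs.1⟩
    _ ≤ _ := by
        rw [← Finset.sum_mul]
        exact mul_le_mul_of_nonneg_right
          (sum_geometric_tail_le (Real.exp_pos _).le hr s₀ D.p) hX0.le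

theorem expectedPosterior_largeSet_le (hX : D.X ≠ 0) {A₁ A₂ A₃ A₄ M₂ ε : ℝ} (hA₁ : 0 < A₁)
    (hA₂ : 0 < A₂) (hA₄ : 0 < A₄) (hM₂ : 3 < M₂) {w : ℕ → ℝ}
    (hw : D.IsSizePrior A₁ A₂ A₃ A₄ w) (hε0 : 0 < ε) (hε1 : ε ≤ 1 / 4)
    (hε : ε ≤ A₄ * (1 - 3 / M₂) / 4) (hn1 : 1 ≤ Real.log n) (hn4 : Real.log 4 ≤ ε * Real.log n)
    (hnA : Real.log A₂ ≤ ε * Real.log n) (hn9 : 81 ≤ ε ^ 2 * Real.log n)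
    {β₀ : D.Coef} (hβ : β₀ ∈ D.trueSet (1 / 8000)) :
    D.expectedPosterior w β₀ (D.largeSet A₄ M₂ β₀) ≤
      ENNReal.ofReal (3 * Real.exp (-(ε * Real.log n))) := by
  classical
  have hlogL := D.log_le_logFactor hX
  have hL : 0 < D.logFactor := by linarith
  have hεL : ε * Real.log n ≤ ε * D.logFactor := mul_le_mul_of_nonneg_left hlogL hε0.le
  -- On the exceptional event the posterior is bounded by `1`; this holds even for a degenerate
  -- quotient.
  have hpost (z : D.Response) : D.posterior w z (D.largeSet A₄ M₂ β₀) ≤ 1 :=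
    (ENNReal.div_le_div_right (MeasureTheory.setLIntegral_le_lintegral _ _) _).trans
      ENNReal.div_self_le_one
  have hbad := D.sum_lik_not_scoreSmall_le hX hL.le β₀
  have hbad2 : (D.p : ℝ) * 2 ^ D.maxGroupSize * Real.exp (-(3 / 2 * D.logFactor)) ≤
      Real.exp (-(ε * D.logFactor)) := by
    have h2 : (2 : ℝ) ^ D.maxGroupSize ≤ Real.exp (ε * D.logFactor) := by
      calc (2 : ℝ) ^ D.maxGroupSize ≤ 4 ^ D.maxGroupSize := by gcongr; norm_num
        _ = Real.exp (D.maxGroupSize * Real.log 4) := by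
            rw [Real.exp_nat_mul, Real.exp_log (by norm_num)]
        _ ≤ _ := by
            refine Real.exp_le_exp.2 ?_
            have h3 : D.maxGroupSize * Real.log 4 ≤ D.maxGroupSize * (ε * Real.log n) := by
              gcongr
            nlinarith [mul_le_mul_of_nonneg_left D.maxGroupSize_mul_log_le hε0.le]
    calc _ ≤ Real.exp D.logFactor * Real.exp (ε * D.logFactor) *
          Real.exp (-(3 / 2 * D.logFactor)) := by
          gcongr
          exact D.p_le_exp_logFactor hX
      _ ≤ _ := by
          rw [← Real.exp_add, ← Real.exp_add]
          refine Real.exp_le_exp.2 ?_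
          nlinarith
  rw [expectedPosterior, ← Finset.sum_filter_add_sum_filter_not Finset.univ (D.ScoreSmall β₀)]
  have h1 : ∑ z with D.ScoreSmall β₀ z,
      ENNReal.ofReal (D.lik β₀ z) * D.posterior w z (D.largeSet A₄ M₂ β₀) ≤
      ENNReal.ofReal (2 * Real.exp (-(ε * D.logFactor))) := by
    calc _ ≤ ∑ z with D.ScoreSmall β₀ z, ENNReal.ofReal (D.lik β₀ z) *
          ENNReal.ofReal (2 * Real.exp (-(ε * D.logFactor))) := by
          refine Finset.sum_le_sum fun z hz => ?_
          gcongr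
          exact posterior_largeSet_le hX hA₁ hA₂ hA₄ hM₂ hw hε0 hε1 hε hn1 hn4 hnA hn9 hβ
            (Finset.mem_filter.1 hz).2
      _ ≤ ∑ z, ENNReal.ofReal (D.lik β₀ z) *
          ENNReal.ofReal (2 * Real.exp (-(ε * D.logFactor))) :=
          Finset.sum_le_sum_of_subset (Finset.filter_subset _ _)
      _ = _ := by
          rw [← Finset.sum_mul, ← ENNReal.ofReal_sum_of_nonneg fun z _ => (D.lik_pos β₀ z).le,
            sum_lik, ENNReal.ofReal_one, one_mul]
  have h2 : ∑ z with ¬ D.ScoreSmall β₀ z,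
      ENNReal.ofReal (D.lik β₀ z) * D.posterior w z (D.largeSet A₄ M₂ β₀) ≤
      ENNReal.ofReal (Real.exp (-(ε * D.logFactor))) := by
    calc _ ≤ ∑ z with ¬ D.ScoreSmall β₀ z, ENNReal.ofReal (D.lik β₀ z) :=
          Finset.sum_le_sum fun z _ => mul_le_of_le_one_right zero_le (hpost z)
      _ = ENNReal.ofReal (∑ z with ¬ D.ScoreSmall β₀ z, D.lik β₀ z) :=
          (ENNReal.ofReal_sum_of_nonneg fun z _ => (D.lik_pos β₀ z).le).symm
      _ ≤ _ := ENNReal.ofReal_le_ofReal (hbad.trans hbad2)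
  refine (add_le_add h1 h2).trans ?_
  rw [← ENNReal.ofReal_add (by positivity) (by positivity)]
  refine ENNReal.ofReal_le_ofReal ?_
  have := Real.exp_le_exp.2 (neg_le_neg hεL)
  linarith

end LogitDesign

end

/-! ### The limit in `n` -/

theorem theorem1 :
    ∃ M₁ : ℝ, 0 < M₁ ∧
      ∀ (A₁ A₂ A₃ A₄ : ℝ), 0 < A₁ → 0 < A₂ → 0 < A₃ → 0 < A₄ →
      ∀ (D : (n : ℕ) → LogitDesign n) (w : ℕ → ℕ → ℝ),
        (∀ n, 1 ≤ n → (D n).X ≠ 0) →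
        (∀ n, 1 ≤ n → (D n).IsSizePrior A₁ A₂ A₃ A₄ (w n)) →
        ∀ M₂ : ℝ, 3 < M₂ →
          Filter.Tendsto
            (fun n : ℕ => ⨆ β₀ ∈ (D n).trueSet M₁,
              (D n).expectedPosterior (w n) β₀ ((D n).largeSet A₄ M₂ β₀))
            Filter.atTop (nhds 0) := by
  refine ⟨1 / 8000, by norm_num, ?_⟩
  intro A₁ A₂ A₃ A₄ hA₁ hA₂ _ hA₄ D w hX hw M₂ hM₂
  have hfrac : 0 < 1 - 3 / M₂ := by
    rw [sub_pos, div_lt_one (by linarith)]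
    exact hM₂
  -- A quarter of the room that `M₂ > 3` leaves in the prior rate `A₄`. The resulting bound
  -- `3n^{-ε}` does not depend on `β₀`, hence passes to the supremum.
  set ε := min (1 / 4) (A₄ * (1 - 3 / M₂) / 4)
  have hε0 : 0 < ε := lt_min (by norm_num) (by positivity)
  have hlog : Filter.Tendsto (fun n : ℕ => Real.log n) Filter.atTop Filter.atTop :=
    Real.tendsto_log_atTop.comp tendsto_natCast_atTop_atTop
  have hεlog : Filter.Tendsto (fun n : ℕ => ε * Real.log n) Filter.atTop Filter.atTop :=
    hlog.const_mul_atTop hε0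
  have hlim : Filter.Tendsto
      (fun n : ℕ => ENNReal.ofReal (3 * Real.exp (-(ε * Real.log n)))) Filter.atTop (nhds 0) := by
    rw [← ENNReal.ofReal_zero]
    refine (ENNReal.continuous_ofReal.tendsto 0).comp ?_
    have := (Real.tendsto_exp_neg_atTop_nhds_zero.comp hεlog).const_mul 3
    simpa using this
  refine tendsto_of_tendsto_of_tendsto_of_le_of_le' tendsto_const_nhds hlim
    (Filter.Eventually.of_forall fun n => zero_le) ?_
  filter_upwards [Filter.eventually_ge_atTop 1, hlog.eventually_ge_atTop 1,
    hεlog.eventually_ge_atTop (Real.log 4), hεlog.eventually_ge_atTop (Real.log A₂),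
    (hlog.const_mul_atTop (pow_pos hε0 2)).eventually_ge_atTop 81] with n hn h1 h4 hA h9
  exact iSup₂_le fun β₀ hβ => LogitDesign.expectedPosterior_largeSet_le (hX n hn) hA₁ hA₂ hA₄ hM₂
    (hw n hn) hε0 (min_le_left _ _) (min_le_right _ _) h1 h4 hA h9 hβ
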